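/- Let $K$ be a field of characteristic $0$. For compositions $\lambda=(\lambda_1,\dots,\lambda_r)$ and $\mu=(\mu_1,\dots,\mu_s)$ of $n\ge 0$, the seaweed algebra $\mathfrak p_n\frac{\lambda}{\mu}\subseteq\mathfrak{gl}_n(K)$ consists of the matrices whose nonzero entries above the diagonal lie in the diagonal blocks of sizes $\lambda_1,\dots,\lambda_r$ and whose nonzero entries below the diagonal lie in the diagonal blocks of sizes $\mu_1,\dots,\mu_s$. A meander $\frac{\lambda}{\mu}$ with $n$ nodes is (the planar graph encoded by) such a pair $(\lambda,\mu)$, and its index is the index of the Lie algebra $\mathfrak g=\mathfrak p_n\frac{\lambda}{\mu}$, that is, $\min_{f\in\mathfrak g^*}\dim\{x\in\mathfrak g : f([x,y])=0\text{ for all }y\in\mathfrak g\}$. For a set $J$ of positive integers let $a^J_{n,k}$ be the number of meanders with $n$ nodes, index $k$ and all parts of $\lambda$ and $\mu$ in $J$ (the empty meander, with $n=0$ and index $0$, is counted), and put $A_J(x,y)=\sum_{n,k\ge 0}a^J_{n,k}x^ny^k$. Let $i^J_{n,k}$ be the number of those meanders counted by $a^J_{n,k}$ that are indecomposable, i.e.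 that have $n\ge 1$ and are not of the form $\frac{\lambda'|\lambda''}{\mu'|\mu''}$ (concatenation of compositions) for meanders $\frac{\lambda'}{\mu'}$, $\frac{\lambda''}{\mu''}$ with strictly fewer than $n$ nodes each. **Theorem.** As formal power series, $$A_{\{1,3\}}(x,y)=\frac{1-x^2y-x^3y}{(1-x^2y-x^3y)(1-xy-x^3y^3)-2x^3y^2(1+x)}.$$ Moreover, $i^{\{1,3\}}_{n,k}=i^{\{1,3\}}_{n-2,k-1}+i^{\{1,3\}}_{n-3,k-1}$ for all $n\ge 7$ and $k\ge 1$, and for every integer $c\ge 1$, $A_{\{c,3c\}}(x,y)=A_{\{1,3\}}(x^c,y^c)$. -/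

import Mathlib

-- The commutator bracket on matrices.
attribute [local instance 100] LieRing.ofAssociativeRing

/-- The stabilizer `{x ∈ L | f ⁅x, y⁆ = 0 for all y ∈ L}` of a linear form `f` under the
coadjoint action of the Lie algebra `L`. -/
def coadjointStabilizer (K : Type*) (L : Type*) [Field K] [LieRing L] [LieAlgebra K L]
    (f : Module.Dual K L) : Submodule K L where
  carrier := {x | ∀ y : L, f ⁅x, y⁆ = 0}
  zero_mem' := fun y => by simp
  add_mem' := fun {a b} ha hb y => by
    have h1 : f ⁅a, y⁆ = 0 := ha y
    have h2 : f ⁅b, y⁆ = 0 := hb y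
    simp [h1, h2]
  smul_mem' := fun r a ha y => by
    have h1 : f ⁅a, y⁆ = 0 := ha y
    simp [h1]

/-- The index of a (finite-dimensional) Lie algebra: the minimal dimension of the stabilizers of
linear forms under the coadjoint action. -/
noncomputable def lieIndex (K : Type*) (L : Type*) [Field K] [LieRing L] [LieAlgebra K L] : ℕ :=
  ⨅ f : Module.Dual K L, Module.finrank K (coadjointStabilizer K L f)

/-- The block number of a position is monotone in the position. -/
theorem composition_index_mono {n : ℕ} (a : Composition n) {i j : Fin n} (h : i ≤ j) :
    a.index i ≤ a.index j := by
  by_contra hlt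
  have h1 : (a.index j : ℕ) + 1 ≤ (a.index i : ℕ) := by
    have := not_le.mp hlt
    exact this
  have h2 := a.lt_sizeUpTo_index_succ j
  have h3 := a.sizeUpTo_index_le i
  have h4 := a.monotone_sizeUpTo h1
  have h5 : (i : ℕ) ≤ (j : ℕ) := h
  simp only [Fin.val_succ] at h2
  omega

/-- The positions `(i, j)` at which a matrix of the seaweed algebra of the pair `(a, b)` may be
nonzero: above the diagonal they lie in the diagonal blocks of `a`, below the diagonal in the
diagonal blocks of `b`. -/
def SeaweedPosition {n : ℕ} (a b : Composition n) (i j : Fin n) : Prop :=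
  (i < j → a.index i = a.index j) ∧ (j < i → b.index i = b.index j)

theorem SeaweedPosition.trans {n : ℕ} {a b : Composition n} {i k j : Fin n}
    (h1 : SeaweedPosition a b i k) (h2 : SeaweedPosition a b k j) : SeaweedPosition a b i j := by
  have key : ∀ c : Composition n, ∀ p q r : Fin n, p < q →
      (p < r → c.index p = c.index r) → (r < q → c.index r = c.index q) →
      c.index p = c.index q := by
    intro c p q r hpq h h'
    rcases lt_trichotomy p r with hpr | rfl | hpr
    · rcases lt_trichotomy r q with hrq | rfl | hrq
      · exact (h hpr).trans (h' hrq)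
      · exact h hpr
      · refine le_antisymm (composition_index_mono c hpq.le) ?_
        rw [h hpr]
        exact composition_index_mono c hrq.le
    · exact h' hpq
    · refine le_antisymm (composition_index_mono c hpq.le) ?_
      rw [← h' (hpr.trans hpq)]
      exact composition_index_mono c hpr.le
  exact ⟨fun h => key a i j k h h1.1 h2.1,
    fun h => (key b j i k h (fun h' => (h2.2 h').symm) (fun h' => (h1.2 h').symm)).symm⟩

/-- A product of two matrices supported on the seaweed positions is again so supported. -/
theorem seaweed_mul {K : Type*} [Field K] {n : ℕ} {a b : Composition n}
    {M N : Matrix (Fin n) (Fin n) K}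
    (hM : ∀ i j, M i j ≠ 0 → SeaweedPosition a b i j)
    (hN : ∀ i j, N i j ≠ 0 → SeaweedPosition a b i j) (i j : Fin n)
    (h : (M * N) i j ≠ 0) : SeaweedPosition a b i j := by
  rw [Matrix.mul_apply] at h
  obtain ⟨k, -, hk⟩ := Finset.exists_ne_zero_of_sum_ne_zero h
  exact (hM i k (left_ne_zero_of_mul hk)).trans (hN k j (right_ne_zero_of_mul hk))

/-- The seaweed algebra of the pair of compositions `(a, b)` of `n`, a Lie subalgebra of
`𝔤𝔩ₙ(K)` (with the commutator bracket). -/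
def seaweedAlgebra (K : Type*) [Field K] {n : ℕ} (a b : Composition n) :
    LieSubalgebra K (Matrix (Fin n) (Fin n) K) where
  carrier := {M | ∀ i j, M i j ≠ 0 → SeaweedPosition a b i j}
  zero_mem' := fun i j h => absurd rfl h
  add_mem' := fun {M N} hM hN i j h => by
    by_cases h0 : M i j = 0
    · refine hN i j fun h1 => h ?_
      simp [h0, h1]
    · exact hM i j h0
  smul_mem' := fun r M hM i j h => hM i j fun h0 => h (by simp [h0])
  lie_mem' := fun {M N} hM hN i j h => by
    by_cases h0 : (M * N) i j = 0
    · refine seaweed_mul hN hM i j fun h1 => h ?_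
      simp [Ring.lie_def, h0, h1]
    · exact seaweed_mul hM hN i j h0

/-- A meander with `n` nodes: its upper and its lower composition, which determine the planar graph
and are determined by it. -/
abbrev Meander (n : ℕ) : Type := Composition n × Composition n

namespace Meander

/-- The index of a meander: the index of the associated seaweed algebra. -/
noncomputable def ind (K : Type*) [Field K] {n : ℕ} (m : Meander n) : ℕ :=
  lieIndex K (seaweedAlgebra K m.1 m.2)

/-- All parts of both compositions belong to `J`. -/
def PartsIn (J : Set ℕ) {n : ℕ} (m : Meander n) : Prop :=
  (∀ p ∈ m.1.blocks, p ∈ J) ∧ (∀ p ∈ m.2.blocks, p ∈ J)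

/-- `m` is the direct sum of `m₁` and `m₂`: both its compositions are concatenations. -/
def IsDirectSum {n n₁ n₂ : ℕ} (m : Meander n) (m₁ : Meander n₁) (m₂ : Meander n₂) : Prop :=
  m.1.blocks = m₁.1.blocks ++ m₂.1.blocks ∧ m.2.blocks = m₁.2.blocks ++ m₂.2.blocks

/-- A nonempty meander that is not the direct sum of two strictly smaller meanders. -/
def Indecomposable {n : ℕ} (m : Meander n) : Prop :=
  0 < n ∧ ¬ ∃ n₁ n₂ : ℕ, n₁ < n ∧ n₂ < n ∧
    ∃ (m₁ : Meander n₁) (m₂ : Meander n₂), m.IsDirectSum m₁ m₂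

end Meander

/-- The number of meanders with `n` nodes, all parts in `J`, and index `k`. -/
noncomputable def meanderCount (K : Type*) [Field K] (J : Set ℕ) (n k : ℕ) : ℕ :=
  Set.ncard {m : Meander n | m.PartsIn J ∧ m.ind K = k}

/-- The number of indecomposable meanders with `n` nodes, all parts in `J`, and index `k`. -/
noncomputable def indecomposableCount (K : Type*) [Field K] (J : Set ℕ) (n k : ℕ) : ℕ :=
  Set.ncard {m : Meander n | m.Indecomposable ∧ m.PartsIn J ∧ m.ind K = k}

/-- The generating function `A_J(x, y) = ∑ a_{n,k} xⁿ yᵏ`, a formal power series in two variables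
`x = X 0` and `y = X 1`. -/
noncomputable def meanderSeries (K : Type*) [Field K] (J : Set ℕ) : MvPowerSeries (Fin 2) ℚ :=
  fun d => (meanderCount K J (d 0) (d 1) : ℚ)

/-! The index of a meander obeys two reduction rules. Equal first parts p split off a direct summand
𝔤𝔩_p, which contributes p (`listIndex_cons_cons`, `relIndex_full`). If the first parts are c above
and 3c below, the first c nodes can be deleted and 3c replaced by c|c without changing the index
(`listIndex_cons_three_mul_cons`).

For the second rule, let V consist of the matrices whose columns lie in the first c nodes and whose
rows lie in the rest of the large block; V is an abelian ideal. A generic linear form is conjugate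
to one that, on V, is the trace of the square block with rows the last c nodes of the large block.
For such a form the orthogonal of V is V plus a copy of the smaller seaweed algebra, and symplectic
reduction by V preserves the dimension of the stabilizer (`finrank_stabilizer_reduction`,
`ReductionDatum.relIndex_eq`). Generic forms suffice, because along a line the stabilizer exceeds
its dimension at a given point only finitely often (`finite_finrank_stabilizer_lt`).

For parts in {1, 3} the rules close up on three families of pairs (a, b): equal sums, with series S;
sums n + 1 and n, with index that of a over 1|b, series T₁; sums n + 2 and n, with index that of a
over 1|1|b, series T₂. Splitting by first parts gives S = 1 + (xy + x³y³)S + 2x³T₂, T₂ = y(1 + x)T₁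
and T₁ = yS + x²T₂; eliminating T₁ and T₂ gives the formula. For indecomposable meanders the same
recursions hold, except that nothing may follow a common partial sum
(`reductionWeight_noCommonCut`); the terms in S then vanish in high degree and the two-term
recurrence remains. Finally, both rules are uniform in c, so multiplying all parts by c multiplies
the index by c (`listIndex_map_mul`). -/

section Index

variable {K : Type*} [Field K]

/-! ### Index of a Lie algebra: invariance, semicontinuity, symplectic reduction, products -/

section General

variable {L : Type*} [LieRing L] [LieAlgebra K L]

theorem mem_coadjointStabilizer {f : Module.Dual K L} {x : L} :
    x ∈ coadjointStabilizer K L f ↔ ∀ y : L, f ⁅x, y⁆ = 0 := Iff.rfl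

theorem lieIndex_le (f : Module.Dual K L) :
    lieIndex K L ≤ Module.finrank K (coadjointStabilizer K L f) :=
  ciInf_le' _ f

theorem exists_finrank_eq_lieIndex :
    ∃ f : Module.Dual K L, Module.finrank K (coadjointStabilizer K L f) = lieIndex K L :=
  Nat.sInf_mem (Set.range_nonempty _)

theorem le_lieIndex {k : ℕ}
    (h : ∀ f : Module.Dual K L, k ≤ Module.finrank K (coadjointStabilizer K L f)) :
    k ≤ lieIndex K L := by
  obtain ⟨f, hf⟩ := exists_finrank_eq_lieIndex (K := K) (L := L)
  exact hf ▸ h f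

/-- The Kirillov form `(x, y) ↦ f ⁅x, y⁆`. -/
def kirillovForm (f : Module.Dual K L) : L →ₗ[K] Module.Dual K L :=
  LinearMap.mk₂ K (fun x y => f ⁅x, y⁆) (by simp) (by simp) (by simp) (by simp)

@[simp] theorem kirillovForm_apply (f : Module.Dual K L) (x y : L) :
    kirillovForm f x y = f ⁅x, y⁆ := rfl

theorem ker_kirillovForm (f : Module.Dual K L) :
    LinearMap.ker (kirillovForm f) = coadjointStabilizer K L f := by
  ext x
  simp [LinearMap.ext_iff, mem_coadjointStabilizer]

theorem finrank_stabilizer_comp {L' : Type*} [LieRing L'] [LieAlgebra K L']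
    (e : L ≃ₗ[K] L') (he : ∀ x y, e ⁅x, y⁆ = ⁅e x, e y⁆) (f : Module.Dual K L') :
    Module.finrank K (coadjointStabilizer K L (f ∘ₗ e.toLinearMap)) =
      Module.finrank K (coadjointStabilizer K L' f) := by
  have : coadjointStabilizer K L (f ∘ₗ e.toLinearMap) =
      (coadjointStabilizer K L' f).comap e.toLinearMap := by
    ext x
    simp only [mem_coadjointStabilizer, Submodule.mem_comap]
    refine ⟨fun h y => ?_, fun h y => ?_⟩
    · have := h (e.symm y)
      simpa [he] using this
    · have := h (e y)
      simpa [he] using this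
  rw [this]
  exact (LinearEquiv.ofSubmodule' e (coadjointStabilizer K L' f)).finrank_eq

theorem lieIndex_congr {L' : Type*} [LieRing L'] [LieAlgebra K L']
    (e : L ≃ₗ[K] L') (he : ∀ x y, e ⁅x, y⁆ = ⁅e x, e y⁆) : lieIndex K L = lieIndex K L' := by
  apply le_antisymm
  · refine le_lieIndex fun f => ?_
    rw [← finrank_stabilizer_comp e he]
    exact lieIndex_le _
  · refine le_lieIndex fun f => ?_
    have : f = (f ∘ₗ e.symm.toLinearMap) ∘ₗ e.toLinearMap := by ext; simp
    rw [this, finrank_stabilizer_comp e he]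
    exact lieIndex_le _

end General

/-- The rank of a linear map does not drop along a line, up to finitely many exceptions. -/
theorem finite_finrank_range_lt {V W : Type*} [AddCommGroup V] [Module K V]
    [FiniteDimensional K V] [AddCommGroup W] [Module K W] [FiniteDimensional K W]
    (f g : V →ₗ[K] W) :
    {t : K | Module.finrank K (LinearMap.range (f + t • g)) <
      Module.finrank K (LinearMap.range f)}.Finite := by
  set r := Module.finrank K (LinearMap.range f)
  let b : Module.Basis (Fin r) K (LinearMap.range f) := Module.finBasis K _
  have hb : ∀ i, ∃ v, f v = b i := fun i => (b i).2
  choose v hv using hb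
  obtain ⟨q, hq⟩ := LinearMap.exists_extend b.equivFun.toLinearMap
  have hqb : ∀ i, q (f (v i)) = Pi.single i 1 := fun i => by
    rw [hv]
    have := LinearMap.congr_fun hq (b i)
    simp only [LinearMap.comp_apply, Submodule.subtype_apply] at this
    rw [this]
    ext j
    simp [Pi.single_apply, eq_comm]
  -- An r × r minor of `f + t • g` as a polynomial in t; at t = 0 it is the identity determinant, so
  -- it has finitely many roots.
  let P : Matrix (Fin r) (Fin r) (Polynomial K) := Matrix.of fun i j =>
    Polynomial.C (q (f (v i)) j) + Polynomial.X * Polynomial.C (q (g (v i)) j)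
  have hP : ∀ t, P.det.eval t = (Matrix.of fun i => q ((f + t • g) (v i))).det := fun t => by
    rw [← Polynomial.coe_evalRingHom, RingHom.map_det]
    congr 1
    ext i j
    simp [P, mul_comm t]
  have h0 : P.det ≠ 0 := by
    intro h
    have := hP 0
    have h1 : (Matrix.of fun i => q ((f + (0 : K) • g) (v i))) = 1 := by
      ext i j
      simp [hqb, Matrix.one_apply, Pi.single_apply, eq_comm]
    rw [h, h1] at this
    simp at this
  refine (P.det.rootSet_finite K).subset fun t ht => ?_
  rw [Polynomial.mem_rootSet]
  refine ⟨h0, ?_⟩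
  rw [Polynomial.coe_aeval_eq_eval, hP]
  by_contra hdet
  have hli : LinearIndependent K (Matrix.of fun i => q ((f + t • g) (v i))).row :=
    Matrix.linearIndependent_rows_of_det_ne_zero hdet
  have hli2 : LinearIndependent K fun i => (⟨(f + t • g) (v i), LinearMap.mem_range_self _ _⟩ :
      LinearMap.range (f + t • g)) := by
    apply LinearIndependent.of_comp (q ∘ₗ (LinearMap.range (f + t • g)).subtype)
    exact hli
  have := hli2.fintype_card_le_finrank
  rw [Fintype.card_fin] at this
  exact absurd ht (not_lt.mpr this)

/-- Along a line of linear forms, the dimension of the stabilizer exceeds its value at a given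
point at most finitely often. -/
theorem finite_finrank_stabilizer_lt {L : Type*} [LieRing L] [LieAlgebra K L]
    [FiniteDimensional K L] (f g : Module.Dual K L) :
    {t : K | Module.finrank K (coadjointStabilizer K L f) <
      Module.finrank K (coadjointStabilizer K L (f + t • g))}.Finite := by
  refine (finite_finrank_range_lt (kirillovForm f) (kirillovForm g)).subset fun t ht => ?_
  have h1 := LinearMap.finrank_range_add_finrank_ker (kirillovForm f)
  have h2 := LinearMap.finrank_range_add_finrank_ker (kirillovForm (f + t • g))
  have h3 : kirillovForm (f + t • g) = kirillovForm f + t • kirillovForm g := by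
    ext; simp
  rw [ker_kirillovForm] at h1 h2
  rw [h3] at h2
  simp only [Set.mem_ofPred_eq] at ht ⊢
  omega

/-- Symplectic reduction by a subspace `V` which meets the stabilizer trivially and
whose orthogonal space is `s(H) + V`. -/
theorem finrank_stabilizer_reduction {L H : Type*} [LieRing L] [LieAlgebra K L]
    [FiniteDimensional K L] [LieRing H] [LieAlgebra K H]
    (f : Module.Dual K L) (s : H →ₗ⁅K⁆ L) (V : Submodule K L)
    (hsV : ∀ z, ∀ v ∈ V, f ⁅s z, v⁆ = 0)
    (hN : ∀ x, (∀ v ∈ V, f ⁅x, v⁆ = 0) → ∃ z, x - s z ∈ V)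
    (hV : ∀ v ∈ V, (∀ y, f ⁅v, y⁆ = 0) → v = 0) (hinj : ∀ z, s z ∈ V → z = 0) :
    Module.finrank K (coadjointStabilizer K L f) =
      Module.finrank K (coadjointStabilizer K H (f ∘ₗ (s : H →ₗ[K] L))) := by
  have hswap : ∀ x y, f ⁅x, y⁆ = 0 → f ⁅y, x⁆ = 0 := fun x y h => by
    rw [← lie_skew, map_neg, h, neg_zero]
  -- An element stabilizing the restricted form is corrected by some v in V. By the double
  -- annihilator, the functionals f⁅v, ·⁆ with v in V are exactly those that vanish on the
  -- orthogonal of V, and f⁅s z, ·⁆ is one of them.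
  have key : ∀ z : coadjointStabilizer K H (f ∘ₗ (s : H →ₗ[K] L)), ∃ v ∈ V,
      s z + v ∈ coadjointStabilizer K L f := by
    rintro ⟨z, hz⟩
    have hmem : kirillovForm f (s z) ∈ V.map (kirillovForm f) := by
      rw [← Subspace.dualCoannihilator_dualAnnihilator_eq (W := V.map (kirillovForm f)),
        Submodule.mem_dualAnnihilator]
      intro x hx
      rw [Submodule.mem_dualCoannihilator] at hx
      obtain ⟨z', hz'⟩ := hN x fun v hv => hswap _ _ (hx _ ⟨v, hv, rfl⟩)
      have : x = s z' + (x - s z') := by abel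
      rw [kirillovForm_apply, this, lie_add, map_add, hsV z _ hz', add_zero, ← LieHom.map_lie]
      exact hz z'
    obtain ⟨v, hv, hvz⟩ := hmem
    refine ⟨-v, V.neg_mem hv, fun y => ?_⟩
    have := LinearMap.congr_fun hvz y
    simp only [kirillovForm_apply] at this
    rw [add_lie, neg_lie, map_add, map_neg, this, add_neg_cancel]
  choose w hwV hw using key
  have huniq : ∀ v ∈ V, v ∈ coadjointStabilizer K L f → v = 0 := fun v hv h => hV v hv h
  -- The correction is unique because V meets the stabilizer trivially; this makes the chosen `w`
  -- linear.
  let T : coadjointStabilizer K H (f ∘ₗ (s : H →ₗ[K] L)) →ₗ[K] coadjointStabilizer K L f :=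
    { toFun := fun z => ⟨s z + w z, hw z⟩
      map_add' := fun a b => by
        apply Subtype.ext
        rw [← sub_eq_zero]
        have h2 := Submodule.sub_mem _ (hw (a + b)) (Submodule.add_mem _ (hw a) (hw b))
        refine huniq _ ?_ h2
        have : (s ↑(a + b) + w (a + b)) - (s a + w a + (s b + w b)) = w (a + b) - (w a + w b) := by
          rw [Submodule.coe_add, map_add]; abel
        change (s ↑(a + b) + w (a + b)) - (s a + w a + (s b + w b)) ∈ V
        rw [this]
        exact V.sub_mem (hwV _) (V.add_mem (hwV _) (hwV _))
      map_smul' := fun c a => by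
        apply Subtype.ext
        rw [← sub_eq_zero]
        have h2 := Submodule.sub_mem _ (hw (c • a)) (Submodule.smul_mem _ c (hw a))
        refine huniq _ ?_ h2
        have : (s ↑(c • a) + w (c • a)) - c • (s a + w a) = w (c • a) - c • w a := by
          rw [Submodule.coe_smul, map_smul, smul_add]; abel
        change (s ↑(c • a) + w (c • a)) - c • (s a + w a) ∈ V
        rw [this]
        exact V.sub_mem (hwV _) (V.smul_mem _ (hwV _)) }
  have hT : Function.Bijective T := by
    constructor
    · rw [← LinearMap.ker_eq_bot, LinearMap.ker_eq_bot']
      intro z hz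
      have h1 : s z + w z = 0 := congrArg Subtype.val hz
      apply Subtype.ext
      refine hinj _ ?_
      rw [eq_neg_of_add_eq_zero_left h1]
      exact V.neg_mem (hwV z)
    · rintro ⟨x, hx⟩
      obtain ⟨z, hz⟩ := hN x fun v _ => hx v
      have hzs : z ∈ coadjointStabilizer K H (f ∘ₗ (s : H →ₗ[K] L)) := fun y => by
        have h1 : s z = x - (x - s z) := by abel
        change f (s ⁅z, y⁆) = 0
        rw [LieHom.map_lie, h1, sub_lie, map_sub, hx, hswap _ _ (hsV y _ hz), sub_zero]
      refine ⟨⟨z, hzs⟩, Subtype.ext ?_⟩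
      rw [← sub_eq_zero]
      refine huniq _ ?_ (Submodule.sub_mem _ (hw ⟨z, hzs⟩) hx)
      have : s z + w ⟨z, hzs⟩ - x = w ⟨z, hzs⟩ - (x - s z) := by abel
      change s z + w ⟨z, hzs⟩ - x ∈ V
      rw [this]
      exact V.sub_mem (hwV _) hz
  exact (LinearEquiv.ofBijective T hT).finrank_eq.symm

/-- The product of two submodules, as a module, is the product of the modules. -/
def submoduleProdEquiv {V W : Type*} [AddCommGroup V] [Module K V] [AddCommGroup W] [Module K W]
    (p : Submodule K V) (q : Submodule K W) : p.prod q ≃ₗ[K] p × q where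
  toFun x := (⟨x.1.1, x.2.1⟩, ⟨x.1.2, x.2.2⟩)
  invFun x := ⟨(x.1, x.2), x.1.2, x.2.2⟩
  map_add' _ _ := rfl
  map_smul' _ _ := rfl
  left_inv _ := rfl
  right_inv _ := rfl

/-- The index is additive under direct products. -/
theorem lieIndex_prod {L L₁ L₂ : Type*} [LieRing L] [LieAlgebra K L] [LieRing L₁]
    [LieAlgebra K L₁] [LieRing L₂] [LieAlgebra K L₂] [FiniteDimensional K L₁]
    [FiniteDimensional K L₂] (e : (L₁ × L₂) ≃ₗ[K] L)
    (he : ∀ x y, ⁅e x, e y⁆ = e (⁅x.1, y.1⁆, ⁅x.2, y.2⁆)) :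
    lieIndex K L = lieIndex K L₁ + lieIndex K L₂ := by
  have key : ∀ f : Module.Dual K L, Module.finrank K (coadjointStabilizer K L f) =
      Module.finrank K (coadjointStabilizer K L₁ (f ∘ₗ e.toLinearMap ∘ₗ LinearMap.inl K L₁ L₂)) +
      Module.finrank K
        (coadjointStabilizer K L₂ (f ∘ₗ e.toLinearMap ∘ₗ LinearMap.inr K L₁ L₂)) := by
    intro f
    have h1 : (coadjointStabilizer K L f).comap e.toLinearMap =
        (coadjointStabilizer K L₁ (f ∘ₗ e.toLinearMap ∘ₗ LinearMap.inl K L₁ L₂)).prod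
          (coadjointStabilizer K L₂ (f ∘ₗ e.toLinearMap ∘ₗ LinearMap.inr K L₁ L₂)) := by
      ext ⟨x₁, x₂⟩
      simp only [Submodule.mem_comap, mem_coadjointStabilizer, Submodule.mem_prod]
      refine ⟨fun h => ⟨fun y => ?_, fun y => ?_⟩, fun h y => ?_⟩
      · simpa [he] using h (e (y, 0))
      · simpa [he] using h (e (0, y))
      · obtain ⟨⟨y₁, y₂⟩, rfl⟩ := e.surjective y
        have h1 := h.1 y₁
        have h2 := h.2 y₂
        simp only [LinearMap.comp_apply, LinearMap.inl_apply, LinearMap.inr_apply,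
          LinearEquiv.coe_coe] at h1 h2 ⊢
        rw [he]
        have : ((⁅x₁, y₁⁆, ⁅x₂, y₂⁆) : L₁ × L₂) = (⁅x₁, y₁⁆, 0) + (0, ⁅x₂, y₂⁆) := by simp
        change f (e (⁅x₁, y₁⁆, ⁅x₂, y₂⁆)) = 0
        rw [this, map_add, map_add, h1, h2, add_zero]
    rw [← (LinearEquiv.ofSubmodule' e (coadjointStabilizer K L f)).finrank_eq, h1,
      (submoduleProdEquiv _ _).finrank_eq, Module.finrank_prod]
  apply le_antisymm
  · obtain ⟨f₁, h₁⟩ := exists_finrank_eq_lieIndex (K := K) (L := L₁)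
    obtain ⟨f₂, h₂⟩ := exists_finrank_eq_lieIndex (K := K) (L := L₂)
    -- Forms on the two factors are independent, so both minima are attained by one form.
    have := key (LinearMap.coprod f₁ f₂ ∘ₗ e.symm.toLinearMap)
    have e1 : (LinearMap.coprod f₁ f₂ ∘ₗ e.symm.toLinearMap) ∘ₗ e.toLinearMap ∘ₗ
        LinearMap.inl K L₁ L₂ = f₁ := by ext; simp
    have e2 : (LinearMap.coprod f₁ f₂ ∘ₗ e.symm.toLinearMap) ∘ₗ e.toLinearMap ∘ₗ
        LinearMap.inr K L₁ L₂ = f₂ := by ext; simp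
    rw [e1, e2, h₁, h₂] at this
    rw [← this]
    exact lieIndex_le _
  · refine le_lieIndex fun f => ?_
    rw [key f]
    exact add_le_add (lieIndex_le _) (lieIndex_le _)

end Index

/-! ### Lie algebras of matrices supported on a transitive relation -/

section Incidence

variable (K : Type*) [Field K]

/-- The matrices supported on a transitive relation, as a Lie algebra. -/
def incidenceLie {ι : Type*} [Fintype ι] [DecidableEq ι] (r : ι → ι → Prop)
    (hr : ∀ i j k, r i j → r j k → r i k) : LieSubalgebra K (Matrix ι ι K) where
  carrier := {M | ∀ i j, M i j ≠ 0 → r i j}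
  zero_mem' := fun i j h => absurd rfl h
  add_mem' := fun {M N} hM hN i j h => by
    by_cases h0 : M i j = 0
    · refine hN i j fun h1 => h ?_
      simp [h0, h1]
    · exact hM i j h0
  smul_mem' := fun r M hM i j h => hM i j fun h0 => h (by simp [h0])
  lie_mem' := fun {M N} hM hN i j h => by
    have mul : ∀ {M N : Matrix ι ι K}, (∀ i j, M i j ≠ 0 → r i j) → (∀ i j, N i j ≠ 0 → r i j) →
        (M * N) i j ≠ 0 → r i j := fun hM hN h => by
      rw [Matrix.mul_apply] at h
      obtain ⟨k, -, hk⟩ := Finset.exists_ne_zero_of_sum_ne_zero h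
      exact hr _ _ _ (hM i k (left_ne_zero_of_mul hk)) (hN k j (right_ne_zero_of_mul hk))
    by_cases h0 : (M * N) i j = 0
    · refine mul hN hM fun h1 => h ?_
      simp [Ring.lie_def, h0, h1]
    · exact mul hM hN h0

variable {ι : Type*} [Fintype ι] [DecidableEq ι] {r : ι → ι → Prop}
  {hr : ∀ i j k, r i j → r j k → r i k}

variable {K} in
theorem apply_eq_zero_of_mem_incidenceLie {M : Matrix ι ι K} (hM : M ∈ incidenceLie K r hr)
    {i j : ι} (h : ¬ r i j) : M i j = 0 := by
  by_contra h0
  exact h (hM i j h0)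

variable {K} in
theorem mul_mem_incidenceLie {M N : Matrix ι ι K} (hM : M ∈ incidenceLie K r hr)
    (hN : N ∈ incidenceLie K r hr) : M * N ∈ incidenceLie K r hr := fun i j h => by
  rw [Matrix.mul_apply] at h
  obtain ⟨k, -, hk⟩ := Finset.exists_ne_zero_of_sum_ne_zero h
  exact hr _ _ _ (hM i k (left_ne_zero_of_mul hk)) (hN k j (right_ne_zero_of_mul hk))

variable {K} in
/-- The restriction of a linear form on matrices. -/
def incidenceForm (r : ι → ι → Prop) (hr : ∀ i j k, r i j → r j k → r i k)
    (g : Module.Dual K (Matrix ι ι K)) : Module.Dual K (incidenceLie K r hr) where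
  toFun M := g M.1
  map_add' M N := map_add g M.1 N.1
  map_smul' c M := map_smul g c M.1

variable {K} in
theorem incidenceForm_surjective (f : Module.Dual K (incidenceLie K r hr)) :
    ∃ g, incidenceForm r hr g = f := by
  obtain ⟨g, hg⟩ := LinearMap.exists_extend (p := (incidenceLie K r hr).toSubmodule) f
  exact ⟨g, LinearMap.ext fun M => LinearMap.congr_fun hg M⟩

/-- The index of the Lie algebra of matrices supported on a transitive relation. -/
noncomputable def relIndex (r : ι → ι → Prop) (hr : ∀ i j k, r i j → r j k → r i k) : ℕ :=
  lieIndex K (incidenceLie K r hr)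

theorem relIndex_congr {κ : Type*} [Fintype κ] [DecidableEq κ] {s : κ → κ → Prop}
    (hr : ∀ i j k, r i j → r j k → r i k) (hs : ∀ i j k, s i j → s j k → s i k)
    (e : ι ≃ κ) (h : ∀ i j, r i j ↔ s (e i) (e j)) : relIndex K r hr = relIndex K s hs := by
  let E : incidenceLie K r hr ≃ₗ[K] incidenceLie K s hs :=
    { toFun := fun M => ⟨M.1.submatrix e.symm e.symm, fun i j hij => by
        have := (h _ _).1 (M.2 _ _ hij)
        simpa using this⟩
      invFun := fun M => ⟨M.1.submatrix e e, fun i j hij => (h _ _).2 (M.2 _ _ hij)⟩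
      map_add' := fun _ _ => rfl
      map_smul' := fun _ _ => rfl
      left_inv := fun M => by ext; simp
      right_inv := fun M => by ext; simp }
  refine lieIndex_congr E fun M N => Subtype.ext ?_
  change (M.1 * N.1 - N.1 * M.1).submatrix e.symm e.symm =
    M.1.submatrix e.symm e.symm * N.1.submatrix e.symm e.symm -
      N.1.submatrix e.symm e.symm * M.1.submatrix e.symm e.symm
  rw [Matrix.submatrix_mul_equiv, Matrix.submatrix_mul_equiv]
  rfl

/-- The isomorphism is M ↦ -Mᵀ; the sign turns the anti-automorphism into one that respects
commutators. -/
theorem relIndex_swap (hr : ∀ i j k, r i j → r j k → r i k) :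
    relIndex K (fun i j => r j i) (fun i j k h h' => hr k j i h' h) = relIndex K r hr := by
  let E : incidenceLie K (fun i j => r j i) (fun i j k h h' => hr k j i h' h) ≃ₗ[K]
      incidenceLie K r hr :=
    { toFun := fun M => ⟨-M.1.transpose, fun i j hij => M.2 j i fun h => hij (by simp [h])⟩
      invFun := fun M => ⟨-M.1.transpose, fun i j hij => M.2 j i fun h => hij (by simp [h])⟩
      map_add' := fun M N => by
        apply Subtype.ext
        change -(M.1 + N.1).transpose = -M.1.transpose + -N.1.transpose
        rw [Matrix.transpose_add, neg_add]
      map_smul' := fun c M => by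
        apply Subtype.ext
        change -(c • M.1).transpose = c • -M.1.transpose
        rw [Matrix.transpose_smul, smul_neg]
      left_inv := fun M => Subtype.ext (neg_neg M.1)
      right_inv := fun M => Subtype.ext (neg_neg M.1) }
  refine lieIndex_congr E fun M N => Subtype.ext ?_
  change -(M.1 * N.1 - N.1 * M.1).transpose =
    -M.1.transpose * -N.1.transpose - -N.1.transpose * -M.1.transpose
  rw [Matrix.transpose_sub, Matrix.transpose_mul, Matrix.transpose_mul, neg_mul_neg, neg_mul_neg,
    neg_sub]

theorem relIndex_sum {κ : Type*} [Fintype κ] [DecidableEq κ] {s : κ → κ → Prop}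
    (hr : ∀ i j k, r i j → r j k → r i k) (hs : ∀ i j k, s i j → s j k → s i k)
    (hrs : ∀ i j k, Sum.LiftRel r s i j → Sum.LiftRel r s j k → Sum.LiftRel r s i k) :
    relIndex K (Sum.LiftRel r s) hrs = relIndex K r hr + relIndex K s hs := by
  let E : (incidenceLie K r hr × incidenceLie K s hs) ≃ₗ[K] incidenceLie K (Sum.LiftRel r s) hrs :=
    { toFun := fun M => ⟨Matrix.fromBlocks M.1.1 0 0 M.2.1, fun i j hij => by
        rcases i with i | i <;> rcases j with j | j
        · exact .inl (M.1.2 i j hij)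
        · exact absurd rfl hij
        · exact absurd rfl hij
        · exact .inr (M.2.2 i j hij)⟩
      invFun := fun M => (⟨M.1.toBlocks₁₁, fun i j hij => Sum.liftRel_inl_inl.1 (M.2 _ _ hij)⟩,
        ⟨M.1.toBlocks₂₂, fun i j hij => Sum.liftRel_inr_inr.1 (M.2 _ _ hij)⟩)
      map_add' := fun M N => by
        apply Subtype.ext
        simp [Matrix.fromBlocks_add]
      map_smul' := fun c M => by
        apply Subtype.ext
        simp [Matrix.fromBlocks_smul]
      left_inv := fun M => by ext <;> simp
      right_inv := fun M => by
        apply Subtype.ext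
        ext i j
        rcases i with i | i <;> rcases j with j | j
        · rfl
        · exact (apply_eq_zero_of_mem_incidenceLie M.2 (by simp)).symm
        · exact (apply_eq_zero_of_mem_incidenceLie M.2 (by simp)).symm
        · rfl }
  refine lieIndex_prod E fun M N => Subtype.ext ?_
  change Matrix.fromBlocks M.1.1 0 0 M.2.1 * Matrix.fromBlocks N.1.1 0 0 N.2.1 -
      Matrix.fromBlocks N.1.1 0 0 N.2.1 * Matrix.fromBlocks M.1.1 0 0 M.2.1 =
    Matrix.fromBlocks (M.1.1 * N.1.1 - N.1.1 * M.1.1) 0 0 (M.2.1 * N.2.1 - N.2.1 * M.2.1)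
  simp [Matrix.fromBlocks_multiply, sub_eq_add_neg, Matrix.fromBlocks_neg, Matrix.fromBlocks_add]

end Incidence

/-! ### The index of the full matrix algebra -/

section FullRelation

variable {K : Type*} [Field K]

/-- The index of `𝔤𝔩_p` is `p`. -/
theorem relIndex_full [CharZero K] (p : ℕ) (r : Fin p → Fin p → Prop)
    (hr : ∀ i j k, r i j → r j k → r i k) (hfull : ∀ i j, r i j) : relIndex K r hr = p := by
  have hmem : ∀ M : Matrix (Fin p) (Fin p) K, M ∈ incidenceLie K r hr :=
    fun M i j _ => hfull i j
  let tf : Matrix (Fin p) (Fin p) K → Module.Dual K (incidenceLie K r hr) := fun F =>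
    { toFun := fun M => (F * M.1).trace
      map_add' := fun M N => by simp [Matrix.mul_add]
      map_smul' := fun c M => by simp }
  -- Under the trace pairing the stabilizer of F is the centralizer of F.
  have htf : ∀ F (M N : incidenceLie K r hr), tf F ⁅M, N⁆ = ((F * M.1 - M.1 * F) * N.1).trace := by
    intro F M N
    change (F * (M.1 * N.1 - N.1 * M.1)).trace = _
    rw [Matrix.mul_sub, Matrix.sub_mul, Matrix.trace_sub, Matrix.trace_sub, ← Matrix.mul_assoc,
      ← Matrix.mul_assoc, Matrix.trace_mul_comm (F * N.1), ← Matrix.mul_assoc]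
  have htfsurj : ∀ f, ∃ F, tf F = f := by
    intro f
    obtain ⟨g, rfl⟩ := incidenceForm_surjective f
    refine ⟨Matrix.of fun i j => g (Matrix.single j i 1), LinearMap.ext fun M => ?_⟩
    have h1 : incidenceForm r hr g M = g M.1 := rfl
    have h2 : ∀ i j, g (Matrix.single i j (M.1 i j)) = M.1 i j * g (Matrix.single i j 1) := by
      intro i j
      rw [← smul_eq_mul, ← map_smul, Matrix.smul_single, smul_eq_mul, mul_one]
    rw [h1, Matrix.matrix_eq_sum_single M.1]
    simp only [map_sum, h2]
    change Matrix.trace (_ * M.1) = _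
    simp only [Matrix.trace, Matrix.diag, Matrix.mul_apply, Matrix.of_apply]
    rw [Finset.sum_comm]
    simp [mul_comm]
  -- The entries are distinct in characteristic 0, so the centralizer of D consists of diagonal
  -- matrices. This gives the upper bound.
  let D : Matrix (Fin p) (Fin p) K := Matrix.diagonal fun i => ((i : ℕ) : K)
  have hinj : Function.Injective fun i : Fin p => ((i : ℕ) : K) :=
    Nat.cast_injective.comp Fin.val_injective
  apply le_antisymm
  · refine (lieIndex_le (tf D)).trans ?_
    let T : coadjointStabilizer K _ (tf D) →ₗ[K] (Fin p → K) :=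
      { toFun := fun M i => M.1.1 i i
        map_add' := fun _ _ => rfl
        map_smul' := fun _ _ => rfl }
    have hT : Function.Injective T := by
      rw [← LinearMap.ker_eq_bot, LinearMap.ker_eq_bot']
      rintro ⟨M, hM⟩ h0
      apply Subtype.ext
      apply Subtype.ext
      ext i j
      by_cases hij : i = j
      · subst hij
        exact congrFun h0 i
      · have := hM ⟨Matrix.single j i 1, hmem _⟩
        rw [htf] at this
        have h2 : (D * M.1 - M.1 * D) i j = 0 := by
          simpa [Matrix.trace_mul_single] using this
        simp only [D, Matrix.sub_apply, Matrix.diagonal_mul, Matrix.mul_diagonal] at h2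
        rw [mul_comm, ← mul_sub] at h2
        rcases mul_eq_zero.1 h2 with h | h
        · exact h
        · exact absurd (hinj (sub_eq_zero.1 h)) hij
    have := LinearMap.finrank_le_finrank_of_injective hT
    simpa using this
  · obtain ⟨f, hf⟩ := exists_finrank_eq_lieIndex (K := K) (L := incidenceLie K r hr)
    obtain ⟨F, rfl⟩ := htfsurj f
    -- For the lower bound, a minimizing F is moved along the line towards D. The polynomial Q tests
    -- whether the all-ones vector is cyclic; at D it is a Vandermonde determinant. For generic t
    -- the powers of G are then p independent elements of its centralizer.
    let P : Matrix (Fin p) (Fin p) (Polynomial K) :=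
      F.map Polynomial.C + (Polynomial.X : Polynomial K) • (D - F).map Polynomial.C
    let Q : Polynomial K := (Matrix.of fun i : Fin p => (P ^ (i : ℕ)).mulVec 1).det
    have hQ : ∀ t, Q.eval t =
        (Matrix.of fun i : Fin p => ((F + t • (D - F)) ^ (i : ℕ)).mulVec 1).det := by
      intro t
      rw [← Polynomial.coe_evalRingHom, RingHom.map_det]
      congr 1
      have hP : P.map (Polynomial.evalRingHom t) = F + t • (D - F) := by
        ext i j
        simp [P]
      ext i j
      change Polynomial.evalRingHom t ((P ^ (i : ℕ)).mulVec 1 j) =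
        ((F + t • (D - F)) ^ (i : ℕ)).mulVec 1 j
      have hPi : (P ^ (i : ℕ)).map (Polynomial.evalRingHom t) = (F + t • (D - F)) ^ (i : ℕ) := by
        rw [← hP]
        exact map_pow (Polynomial.evalRingHom t).mapMatrix P i
      rw [RingHom.map_mulVec, hPi]
      congr 1
      ext
      simp
    have hQ0 : Q ≠ 0 := by
      intro h
      have h1 := hQ 1
      rw [h, Polynomial.eval_zero, one_smul, add_sub_cancel] at h1
      have h2 : (Matrix.of fun i : Fin p => (D ^ (i : ℕ)).mulVec 1) =
          (Matrix.vandermonde fun i : Fin p => ((i : ℕ) : K)).transpose := by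
        ext i j
        simp [D, Matrix.diagonal_pow, Matrix.mulVec_diagonal, Matrix.vandermonde]
      rw [h2, Matrix.det_transpose] at h1
      exact Matrix.det_vandermonde_ne_zero_iff.2 hinj h1.symm
    obtain ⟨t, ht⟩ := ((finite_finrank_stabilizer_lt (tf F) (tf (D - F))).union
      (Q.rootSet_finite K)).infinite_compl.nonempty
    simp only [Set.mem_compl_iff, Set.mem_union, Set.mem_ofPred_eq, not_or, not_lt,
      Polynomial.mem_rootSet, not_and, Polynomial.coe_aeval_eq_eval] at ht
    have hdet := ht.2 hQ0
    rw [hQ] at hdet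
    set G := F + t • (D - F) with hG
    have hfG : tf F + t • tf (D - F) = tf G := by
      ext M
      simp [tf, hG, Matrix.add_mul, Matrix.sub_mul, mul_sub]
    rw [hfG, hf] at ht
    refine le_trans ?_ ht.1
    have hpow : ∀ i : Fin p, (⟨G ^ (i : ℕ), hmem _⟩ : incidenceLie K r hr) ∈
        coadjointStabilizer K _ (tf G) := fun i N => by
      rw [htf]
      simp [← pow_succ, ← pow_succ']
    have hli := Matrix.linearIndependent_rows_of_det_ne_zero hdet
    let ev : coadjointStabilizer K _ (tf G) →ₗ[K] (Fin p → K) :=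
      { toFun := fun M => M.1.1.mulVec 1
        map_add' := fun M N => Matrix.add_mulVec _ _ _
        map_smul' := fun c M => Matrix.smul_mulVec _ _ _ }
    have hli2 : LinearIndependent K fun i : Fin p =>
        (⟨⟨G ^ (i : ℕ), hmem _⟩, hpow i⟩ : coadjointStabilizer K _ (tf G)) :=
      LinearIndependent.of_comp ev hli
    simpa using hli2.fintype_card_le_finrank

end FullRelation

/-! ### One reduction step: forms in normal position -/

section Reduction

variable {K : Type*} [Field K] {γ κ : Type*} [Fintype γ] [Fintype κ] [DecidableEq γ]
  [DecidableEq κ]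

theorem toBlocks₁₂_eq_zero {r : γ ⊕ κ → γ ⊕ κ → Prop} {hr : ∀ i j k, r i j → r j k → r i k}
    (h12 : ∀ i j, ¬ r (.inl i) (.inr j)) {x : Matrix (γ ⊕ κ) (γ ⊕ κ) K}
    (hx : x ∈ incidenceLie K r hr) : x.toBlocks₁₂ = 0 := by
  ext i j
  exact apply_eq_zero_of_mem_incidenceLie hx (h12 i j)

theorem commutator_fromBlocks {x : Matrix (γ ⊕ κ) (γ ⊕ κ) K} (hx : x.toBlocks₁₂ = 0)
    (v : Matrix κ γ K) :
    x * Matrix.fromBlocks 0 0 v 0 - Matrix.fromBlocks 0 0 v 0 * x =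
      Matrix.fromBlocks 0 0 (x.toBlocks₂₂ * v - v * x.toBlocks₁₁) 0 := by
  conv_lhs => rw [← Matrix.fromBlocks_toBlocks x]
  simp [Matrix.fromBlocks_multiply, sub_eq_add_neg, Matrix.fromBlocks_neg, Matrix.fromBlocks_add,
    hx]

/-- The data of one step of the reduction: `r` is the relation on `γ ⊕ κ` which is full on `γ`,
equal to `s` on `κ` and relates exactly the elements of `D ⊆ κ` to those of `γ`; `D` contains a copy
`e '' γ` of `γ`, and `s'` is `s` without the pairs in `e '' γ × (D \ e '' γ)`. -/
structure ReductionDatum (r : γ ⊕ κ → γ ⊕ κ → Prop) (s s' : κ → κ → Prop) (D : κ → Prop)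
    (e : γ → κ) : Prop where
  inj : Function.Injective e
  refl : ∀ i, s i i
  lower : ∀ k i, s k i → D i → D k
  mem : ∀ j, D (e j)
  full : ∀ j i, D i → i ∉ Set.range e → s (e j) i
  inl_inl : ∀ i j, r (.inl i) (.inl j)
  inl_inr : ∀ i j, ¬ r (.inl i) (.inr j)
  inr_inl : ∀ i j, r (.inr i) (.inl j) ↔ D i
  inr_inr : ∀ i j, r (.inr i) (.inr j) ↔ s i j
  reduced : ∀ i j, s' i j ↔ s i j ∧ ¬ (i ∈ Set.range e ∧ D j ∧ j ∉ Set.range e)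

variable {r : γ ⊕ κ → γ ⊕ κ → Prop} {s s' : κ → κ → Prop} {D : κ → Prop} {e : γ → κ}

namespace ReductionDatum

theorem fromBlocks_mem (h : ReductionDatum r s s' D e) (hr : ∀ i j k, r i j → r j k → r i k)
    {X : Matrix γ γ K} {Y : Matrix κ γ K} {Z : Matrix κ κ K} (hY : ∀ i j, Y i j ≠ 0 → D i)
    (hZ : ∀ i j, Z i j ≠ 0 → s i j) : Matrix.fromBlocks X 0 Y Z ∈ incidenceLie K r hr := by
  rintro (i | i) (j | j) hij
  · exact h.inl_inl i j
  · exact absurd rfl hij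
  · exact (h.inr_inl i j).2 (hY i j hij)
  · exact (h.inr_inr i j).2 (hZ i j hij)

omit [DecidableEq γ] [DecidableEq κ] in
-- A reduced matrix has no entry from `e '' γ` to the rest of D, so only indices in `e '' γ`
-- contribute. Hence restricting to `e '' γ` is multiplicative, which makes `embed` a Lie
-- homomorphism.
theorem sum_eq_sum_range (h : ReductionDatum r s s' D e) {z : Matrix κ κ K}
    (hz : ∀ i j, z i j ≠ 0 → s' i j) (j : γ) (v : κ → K) (hv : ∀ i, v i ≠ 0 → D i) :
    ∑ k, z (e j) k * v k = ∑ i, z (e j) (e i) * v (e i) := by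
  symm
  refine Finset.sum_of_injOn e h.inj.injOn (fun _ _ => Finset.mem_coe.2 (Finset.mem_univ _))
    (fun k _ hk => ?_) (fun _ _ => rfl)
  by_contra h0
  refine ((h.reduced _ _).1 (hz _ _ (left_ne_zero_of_mul h0))).2
    ⟨⟨j, rfl⟩, hv k (right_ne_zero_of_mul h0), fun ⟨i, hi⟩ => hk ⟨i, by simp, hi⟩⟩

/-- The embedding of the reduced Lie algebra. -/
def embed (h : ReductionDatum r s s' D e) (hr : ∀ i j k, r i j → r j k → r i k)
    (hs' : ∀ i j k, s' i j → s' j k → s' i k) :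
    incidenceLie K s' hs' →ₗ⁅K⁆ incidenceLie K r hr where
  toFun z := ⟨Matrix.fromBlocks (z.1.submatrix e e) 0 0 z.1,
    h.fromBlocks_mem hr (fun _ _ h0 => absurd rfl h0)
      fun i j hij => ((h.reduced i j).1 (z.2 i j hij)).1⟩
  map_add' z w := by
    apply Subtype.ext
    simp [Matrix.fromBlocks_add, Matrix.submatrix_add]
  map_smul' c z := by
    apply Subtype.ext
    simp [Matrix.fromBlocks_smul, Matrix.submatrix_smul]
  map_lie' := by
    intro z w
    apply Subtype.ext
    have key : ∀ z w : incidenceLie K s' hs', (z.1 * w.1).submatrix e e =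
        z.1.submatrix e e * w.1.submatrix e e := by
      intro z w
      ext i j
      simp only [Matrix.submatrix_apply, Matrix.mul_apply]
      exact h.sum_eq_sum_range z.2 i (fun k => w.1 k (e j)) fun k hk =>
        h.lower _ _ ((h.reduced _ _).1 (w.2 _ _ hk)).1 (h.mem j)
    change Matrix.fromBlocks ((z.1 * w.1 - w.1 * z.1).submatrix e e) 0 0
        (z.1 * w.1 - w.1 * z.1) =
      Matrix.fromBlocks (z.1.submatrix e e) 0 0 z.1 * Matrix.fromBlocks (w.1.submatrix e e) 0 0 w.1
      - Matrix.fromBlocks (w.1.submatrix e e) 0 0 w.1 *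
        Matrix.fromBlocks (z.1.submatrix e e) 0 0 z.1
    have hsub : (z.1 * w.1 - w.1 * z.1).submatrix e e =
        (z.1 * w.1).submatrix e e - (w.1 * z.1).submatrix e e := rfl
    rw [hsub, key, key]
    simp [Matrix.fromBlocks_multiply, sub_eq_add_neg, Matrix.fromBlocks_neg,
      Matrix.fromBlocks_add]

theorem embed_val (h : ReductionDatum r s s' D e) (hr : ∀ i j k, r i j → r j k → r i k)
    (hs' : ∀ i j k, s' i j → s' j k → s' i k) (z : incidenceLie K s' hs') :
    (h.embed hr hs' z).1 = Matrix.fromBlocks (z.1.submatrix e e) 0 0 z.1 := rfl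

/-- Symplectic reduction by the lower-left corner V. Testing x against the matrix units of V says
that the rows of its κ-block indexed by `e '' γ` vanish on the rest of D and agree with its γ-block
on `e '' γ`: modulo V, x is the image under `embed` of its κ-block. -/
theorem finrank_stabilizer_normal (h : ReductionDatum r s s' D e)
    (hr : ∀ i j k, r i j → r j k → r i k) (hs' : ∀ i j k, s' i j → s' j k → s' i k)
    (g : Module.Dual K (Matrix (γ ⊕ κ) (γ ⊕ κ) K))
    (hg : ∀ v : Matrix κ γ K, (∀ i j, v i j ≠ 0 → D i) →
      g (Matrix.fromBlocks 0 0 v 0) = ∑ j, v (e j) j) :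
    Module.finrank K (coadjointStabilizer K (incidenceLie K r hr)
        (incidenceForm r hr g)) =
      Module.finrank K (coadjointStabilizer K (incidenceLie K s' hs')
        ((incidenceForm r hr g) ∘ₗ
          (h.embed (K := K) hr hs').toLinearMap)) := by
  let V : Submodule K (incidenceLie K r hr) :=
    { carrier := {x | x.1.toBlocks₁₁ = 0 ∧ x.1.toBlocks₂₂ = 0}
      zero_mem' := ⟨rfl, rfl⟩
      add_mem' := fun {a b} ha hb => by
        refine ⟨?_, ?_⟩
        · change a.1.toBlocks₁₁ + b.1.toBlocks₁₁ = 0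
          rw [ha.1, hb.1, add_zero]
        · change a.1.toBlocks₂₂ + b.1.toBlocks₂₂ = 0
          rw [ha.2, hb.2, add_zero]
      smul_mem' := fun c a ha => by
        refine ⟨?_, ?_⟩
        · change c • a.1.toBlocks₁₁ = 0
          rw [ha.1, smul_zero]
        · change c • a.1.toBlocks₂₂ = 0
          rw [ha.2, smul_zero] }
  have h12 : ∀ x : incidenceLie K r hr, x.1.toBlocks₁₂ = 0 := fun x =>
    toBlocks₁₂_eq_zero h.inl_inr x.2
  have hD : ∀ (x : incidenceLie K r hr) i j, x.1.toBlocks₂₁ i j ≠ 0 → D i := fun x i j hij =>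
    (h.inr_inl i j).1 (x.2 _ _ hij)
  have hZ : ∀ (x : incidenceLie K r hr) i j, x.1.toBlocks₂₂ i j ≠ 0 → s i j := fun x i j hij =>
    (h.inr_inr i j).1 (x.2 _ _ hij)
  have hVform : ∀ v ∈ V, v.1 = Matrix.fromBlocks 0 0 v.1.toBlocks₂₁ 0 := fun v hv => by
    conv_lhs => rw [← Matrix.fromBlocks_toBlocks v.1, hv.1, hv.2, h12]
  -- the value of the form on a commutator
  have hval : ∀ (x : incidenceLie K r hr) (v : Matrix κ γ K), (∀ i j, v i j ≠ 0 → D i) →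
      g (x.1 * Matrix.fromBlocks 0 0 v 0 - Matrix.fromBlocks 0 0 v 0 * x.1) =
        ∑ j, ((x.1.toBlocks₂₂ * v) (e j) j - (v * x.1.toBlocks₁₁) (e j) j) := by
    intro x v hv
    rw [commutator_fromBlocks (h12 x), hg]
    · rfl
    · intro i j hij
      by_cases h0 : (v * x.1.toBlocks₁₁) i j = 0
      · have h1 : (x.1.toBlocks₂₂ * v) i j ≠ 0 := fun h1 => hij (by simp [h0, h1])
        rw [Matrix.mul_apply] at h1
        obtain ⟨k, -, hk⟩ := Finset.exists_ne_zero_of_sum_ne_zero h1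
        exact h.lower _ _ (hZ x _ _ (left_ne_zero_of_mul hk)) (hv _ _ (right_ne_zero_of_mul hk))
      · rw [Matrix.mul_apply] at h0
        obtain ⟨k, -, hk⟩ := Finset.exists_ne_zero_of_sum_ne_zero h0
        exact hv _ _ (left_ne_zero_of_mul hk)
  have hsingle : ∀ i (j : γ), D i → ∀ a b, Matrix.single i j (1 : K) a b ≠ 0 → D a := by
    intro i j hi a b hab
    by_cases hia : i = a
    · exact hia ▸ hi
    · exact absurd (by simp [hia]) hab
  -- the form on a commutator with a matrix unit
  have hunit : ∀ (x : incidenceLie K r hr) i j, D i →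
      g (x.1 * Matrix.fromBlocks 0 0 (Matrix.single i j 1) 0 -
        Matrix.fromBlocks 0 0 (Matrix.single i j 1) 0 * x.1) =
        x.1.toBlocks₂₂ (e j) i - ∑ j', if i = e j' then x.1.toBlocks₁₁ j j' else 0 := by
    intro x i j hi
    rw [hval x _ (hsingle i j hi), Finset.sum_sub_distrib]
    congr 1
    · simp [Matrix.mul_apply, Matrix.single_apply, ite_and, Finset.sum_ite_eq]
    · refine Finset.sum_congr rfl fun j' _ => ?_
      by_cases hij : i = e j'
      · simp [Matrix.mul_apply, Matrix.single_apply, hij]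
      · simp [Matrix.mul_apply, hij]
  refine finrank_stabilizer_reduction _ (h.embed hr hs') V ?_ ?_ ?_ ?_
  · intro z v hv
    change g ((h.embed hr hs' z).1 * v.1 - v.1 * (h.embed hr hs' z).1) = 0
    rw [hVform v hv, hval _ _ (hD v), Finset.sum_sub_distrib, sub_eq_zero]
    simp only [embed_val, Matrix.toBlocks_fromBlocks₂₂, Matrix.toBlocks_fromBlocks₁₁,
      Matrix.mul_apply, Matrix.submatrix_apply]
    simp_rw [fun j => h.sum_eq_sum_range z.2 j (fun k => v.1.toBlocks₂₁ k j) fun k => hD v k j]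
    rw [Finset.sum_comm]
    exact Finset.sum_congr rfl fun _ _ => Finset.sum_congr rfl fun _ _ => mul_comm _ _
  · intro x hx
    have hx' : ∀ i j, D i → x.1.toBlocks₂₂ (e j) i =
        ∑ j', if i = e j' then x.1.toBlocks₁₁ j j' else 0 := by
      intro i j hi
      rw [← sub_eq_zero, ← hunit x i j hi]
      exact hx ⟨Matrix.fromBlocks 0 0 (Matrix.single i j 1) 0,
        h.fromBlocks_mem hr (hsingle i j hi) fun _ _ h0 => absurd rfl h0⟩ ⟨rfl, rfl⟩
    have hz : ∀ i j, x.1.toBlocks₂₂ i j ≠ 0 → s' i j := by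
      intro i j hij
      refine (h.reduced _ _).2 ⟨hZ x _ _ hij, ?_⟩
      rintro ⟨⟨i, rfl⟩, hj, hj'⟩
      refine hij ?_
      rw [hx' j i hj]
      exact Finset.sum_eq_zero fun k _ => if_neg fun hk => hj' ⟨k, hk.symm⟩
    refine ⟨⟨x.1.toBlocks₂₂, hz⟩, ?_, sub_self _⟩
    change x.1.toBlocks₁₁ - x.1.toBlocks₂₂.submatrix e e = 0
    rw [sub_eq_zero]
    ext i j
    rw [Matrix.submatrix_apply, hx' _ _ (h.mem j)]
    simp [h.inj.eq_iff]
  -- Pairing with the γ-block kills the rows of v in `e '' γ`; pairing with the units at (`e j`, i),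
  -- available by `full`, kills the remaining rows in D.
  · intro v hv hy
    have hy' : ∀ y : incidenceLie K r hr, ∑ j, ((y.1.toBlocks₂₂ * v.1.toBlocks₂₁) (e j) j -
        (v.1.toBlocks₂₁ * y.1.toBlocks₁₁) (e j) j) = 0 := by
      intro y
      rw [← hval y _ (hD v), ← hVform v hv, ← neg_eq_zero, ← map_neg, neg_sub]
      exact hy y
    have hrange : ∀ i j, v.1.toBlocks₂₁ (e i) j = 0 := by
      intro i j
      have := hy' ⟨Matrix.fromBlocks (Matrix.single j i 1) 0 0 0,
        h.fromBlocks_mem hr (fun _ _ h0 => absurd rfl h0) (fun _ _ h0 => absurd rfl h0)⟩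
      simpa [Matrix.mul_apply, Matrix.single_apply, ite_and] using this
    rw [show v = 0 ↔ v.1 = 0 from Subtype.ext_iff, hVform v hv]
    suffices v.1.toBlocks₂₁ = 0 by rw [this, Matrix.fromBlocks_zero]
    ext i j
    by_cases hi : D i
    · by_cases hi' : i ∈ Set.range e
      · obtain ⟨i, rfl⟩ := hi'
        exact hrange i j
      · have := hy' ⟨Matrix.fromBlocks 0 0 0 (Matrix.single (e j) i 1),
          h.fromBlocks_mem hr (fun _ _ h0 => absurd rfl h0) fun a b hab => by
            by_cases hab' : e j = a ∧ i = b
            · rw [← hab'.1, ← hab'.2]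
              exact h.full j i hi hi'
            · exact absurd (by simp [hab']) hab⟩
        simpa [Matrix.mul_apply, Matrix.single_apply, ite_and, h.inj.eq_iff] using this
    · by_contra h0
      exact hi (hD v i j h0)
  · intro z hz
    exact Subtype.ext (by simpa [embed_val] using hz.2)

end ReductionDatum

end Reduction

/-! ### One reduction step: equality of indices -/

section ReductionIndex

variable {K : Type*} [Field K]

theorem exists_finrank_stabilizer_conj {ι : Type*} [Fintype ι] [DecidableEq ι] {r : ι → ι → Prop}
    {hr : ∀ i j k, r i j → r j k → r i k} {u u' : Matrix ι ι K} (hu : u ∈ incidenceLie K r hr)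
    (hu' : u' ∈ incidenceLie K r hr) (h1 : u * u' = 1) (h2 : u' * u = 1)
    (g : Module.Dual K (Matrix ι ι K)) :
    ∃ g' : Module.Dual K (Matrix ι ι K), (∀ M, g' M = g (u * M * u')) ∧
      Module.finrank K (coadjointStabilizer K (incidenceLie K r hr) (incidenceForm r hr g')) =
      Module.finrank K (coadjointStabilizer K (incidenceLie K r hr) (incidenceForm r hr g)) := by
  have hc : ∀ {a b : Matrix ι ι K}, a * b = 1 → ∀ x, a * (b * x * a) * b = x := by
    intro a b hab x
    rw [Matrix.mul_assoc b, ← Matrix.mul_assoc a, hab, Matrix.one_mul, Matrix.mul_assoc, hab,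
      Matrix.mul_one]
  let E : incidenceLie K r hr ≃ₗ[K] incidenceLie K r hr :=
    { toFun := fun x => ⟨u * x.1 * u', mul_mem_incidenceLie (mul_mem_incidenceLie hu x.2) hu'⟩
      invFun := fun x => ⟨u' * x.1 * u, mul_mem_incidenceLie (mul_mem_incidenceLie hu' x.2) hu⟩
      map_add' := fun x y => by
        apply Subtype.ext
        change u * (x.1 + y.1) * u' = u * x.1 * u' + u * y.1 * u'
        rw [Matrix.mul_add, Matrix.add_mul]
      map_smul' := fun c x => by
        apply Subtype.ext
        change u * (c • x.1) * u' = c • (u * x.1 * u')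
        rw [Matrix.mul_smul, Matrix.smul_mul]
      left_inv := fun x => Subtype.ext (hc h2 x.1)
      right_inv := fun x => Subtype.ext (hc h1 x.1) }
  refine ⟨g ∘ₗ LinearMap.mulRight K u' ∘ₗ LinearMap.mulLeft K u, fun M => rfl, ?_⟩
  have hE : incidenceForm r hr (g ∘ₗ LinearMap.mulRight K u' ∘ₗ LinearMap.mulLeft K u) =
      incidenceForm r hr g ∘ₗ E.toLinearMap := rfl
  rw [hE]
  refine finrank_stabilizer_comp E (fun x y => Subtype.ext ?_) _
  change u * (x.1 * y.1 - y.1 * x.1) * u' =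
    (u * x.1 * u') * (u * y.1 * u') - (u * y.1 * u') * (u * x.1 * u')
  have key : ∀ x y : Matrix ι ι K, (u * x * u') * (u * y * u') = u * (x * y) * u' := by
    intro x y
    rw [Matrix.mul_assoc (u * x), ← Matrix.mul_assoc u' (u * y), ← Matrix.mul_assoc u' u, h2,
      Matrix.one_mul, ← Matrix.mul_assoc, Matrix.mul_assoc u]
  rw [key, key, Matrix.mul_sub, Matrix.sub_mul]

variable {γ κ : Type*} [Fintype γ] [Fintype κ] [DecidableEq γ] [DecidableEq κ]
  {r : γ ⊕ κ → γ ⊕ κ → Prop} {s s' : κ → κ → Prop} {D : κ → Prop} {e : γ → κ}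

namespace ReductionDatum

/-- A linear form with an invertible pairing between `γ` and `e '' γ` is conjugate to one in
normal form. -/
theorem exists_normal (h : ReductionDatum r s s' D e) (hr : ∀ i j k, r i j → r j k → r i k)
    (g : Module.Dual K (Matrix (γ ⊕ κ) (γ ⊕ κ) K))
    (hdet : (Matrix.of fun j j' : γ =>
      g (Matrix.fromBlocks 0 0 (Matrix.single (e j') j 1) 0)).det ≠ 0) :
    ∃ g' : Module.Dual K (Matrix (γ ⊕ κ) (γ ⊕ κ) K),
      (∀ v : Matrix κ γ K, (∀ i j, v i j ≠ 0 → D i) →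
        g' (Matrix.fromBlocks 0 0 v 0) = ∑ j, v (e j) j) ∧
      Module.finrank K (coadjointStabilizer K (incidenceLie K r hr)
        (incidenceForm r hr g')) =
      Module.finrank K (coadjointStabilizer K (incidenceLie K r hr)
        (incidenceForm r hr g)) := by
  classical
  set Ξ : Matrix γ γ K := Matrix.of fun j j' : γ =>
      g (Matrix.fromBlocks 0 0 (Matrix.single (e j') j 1) 0) with hΞ
  have hunit : IsUnit Ξ.det := hdet.isUnit
  let ξ : Matrix γ κ K := Matrix.of fun j i => g (Matrix.fromBlocks 0 0 (Matrix.single i j 1) 0)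
  let E : Matrix κ γ K := Matrix.of fun i j => if i = e j then 1 else 0
  -- On the corner the form is w ↦ tr(ξw). Conjugation by diag(Ξ, 1 + Ec) replaces ξ by Ξ⁻¹ξ(1 + Ec)
  -- = Ξ⁻¹ξ + c, since ξE = Ξ. The first term is already the identity on `e '' γ`, and c is chosen
  -- to cancel it on the rest of D. As c vanishes on `e '' γ`, (Ec)² = 0 and the inverse is
  -- explicit.
  let c : Matrix γ κ K := Matrix.of fun j k =>
    if D k ∧ k ∉ Set.range e then -(Ξ⁻¹ * ξ) j k else 0
  have hξE : ξ * E = Ξ := by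
    ext j j'
    simp [ξ, E, hΞ, Matrix.mul_apply]
  have hcE : c * E = 0 := by
    ext j j'
    simp [c, E, Matrix.mul_apply]
  have hb : (E * c) * (E * c) = 0 := by
    rw [Matrix.mul_assoc, ← Matrix.mul_assoc c, hcE, Matrix.zero_mul, Matrix.mul_zero]
  have hbs : ∀ i k, (E * c) i k ≠ 0 → s i k := by
    intro i k hik
    rw [Matrix.mul_apply] at hik
    obtain ⟨j, -, hj⟩ := Finset.exists_ne_zero_of_sum_ne_zero hik
    have h1 : i = e j := by
      by_contra h0
      exact left_ne_zero_of_mul hj (by simp [E, h0])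
    have h2 : D k ∧ k ∉ Set.range e := by
      by_contra h0
      exact right_ne_zero_of_mul hj (if_neg h0)
    exact h1 ▸ h.full j k h2.1 h2.2
  have hUs : ∀ b : Matrix κ κ K, (∀ i k, b i k ≠ 0 → s i k) → ∀ i k, (1 + b) i k ≠ 0 → s i k := by
    intro b hb i k hik
    by_cases h0 : i = k
    · exact h0 ▸ h.refl i
    · refine hb i k ?_
      simpa [Matrix.one_apply, h0] using hik
  have hU1 : (1 + E * c) * (1 + -(E * c)) = 1 := by
    rw [← sub_eq_add_neg, add_mul, mul_sub, mul_sub, hb]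
    simp
  have hU2 : (1 + -(E * c)) * (1 + E * c) = 1 := by
    rw [← sub_eq_add_neg, mul_add, sub_mul, sub_mul, hb]
    simp
  let u := Matrix.fromBlocks Ξ 0 0 (1 + E * c)
  let u' := Matrix.fromBlocks Ξ⁻¹ 0 0 (1 + -(E * c))
  have hu : u ∈ incidenceLie K r hr :=
    h.fromBlocks_mem hr (fun _ _ h0 => absurd rfl h0) (hUs _ hbs)
  have hu' : u' ∈ incidenceLie K r hr :=
    h.fromBlocks_mem hr (fun _ _ h0 => absurd rfl h0)
      (hUs _ fun i k hik => hbs i k fun h0 => hik (by simp [h0]))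
  have h1 : u * u' = 1 := by
    simp [u, u', Matrix.fromBlocks_multiply, hU1, Matrix.mul_nonsing_inv _ hunit]
  have h2 : u' * u = 1 := by
    simp [u, u', Matrix.fromBlocks_multiply, hU2, Matrix.nonsing_inv_mul _ hunit]
  obtain ⟨g', hg', hfr⟩ := exists_finrank_stabilizer_conj hu hu' h1 h2 g
  refine ⟨g', fun v hv => ?_, hfr⟩
  have hgv : ∀ w : Matrix κ γ K, g (Matrix.fromBlocks 0 0 w 0) = (ξ * w).trace := by
    intro w
    let T : Matrix κ γ K →ₗ[K] Matrix (γ ⊕ κ) (γ ⊕ κ) K :=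
      { toFun := fun w => Matrix.fromBlocks 0 0 w 0
        map_add' := fun a b => by simp [Matrix.fromBlocks_add]
        map_smul' := fun a b => by simp [Matrix.fromBlocks_smul] }
    have h2 : ∀ i j, (g ∘ₗ T) (Matrix.single i j (w i j)) = ξ j i * w i j := by
      intro i j
      rw [mul_comm, ← smul_eq_mul]
      change _ = _ • (g ∘ₗ T) (Matrix.single i j 1)
      rw [← map_smul, Matrix.smul_single, smul_eq_mul, mul_one]
    change (g ∘ₗ T) w = _
    conv_lhs => rw [Matrix.matrix_eq_sum_single w]
    simp only [map_sum, h2]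
    rw [Finset.sum_comm]
    simp [Matrix.trace, Matrix.mul_apply]
  have huv : u * Matrix.fromBlocks 0 0 v 0 * u' =
      Matrix.fromBlocks 0 0 ((1 + E * c) * v * Ξ⁻¹) 0 := by
    simp [u, u', Matrix.fromBlocks_multiply]
  rw [hg', huv, hgv, ← Matrix.mul_assoc, ← Matrix.mul_assoc, Matrix.trace_mul_comm, ← Matrix.mul_assoc,
    ← Matrix.mul_assoc, Matrix.mul_add, Matrix.mul_one, ← Matrix.mul_assoc,
    Matrix.mul_assoc Ξ⁻¹ ξ E, hξE, Matrix.nonsing_inv_mul _ hunit, Matrix.one_mul]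
  simp only [Matrix.trace, Matrix.diag, Matrix.mul_apply (M := _ + _)]
  refine Finset.sum_congr rfl fun j _ => ?_
  rw [Finset.sum_eq_single (e j)]
  · have h3 : (Ξ⁻¹ * ξ + c) j (e j) = 1 := by
      have : (Ξ⁻¹ * ξ) j (e j) = (Ξ⁻¹ * Ξ) j j := rfl
      rw [Matrix.add_apply, this, Matrix.nonsing_inv_mul _ hunit]
      simp [c]
    rw [h3, one_mul]
  · intro i _ hi
    by_cases hiD : D i
    · by_cases hir : i ∈ Set.range e
      · obtain ⟨j', rfl⟩ := hir
        have : (Ξ⁻¹ * ξ) j (e j') = (Ξ⁻¹ * Ξ) j j' := rfl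
        rw [Matrix.add_apply, this, Matrix.nonsing_inv_mul _ hunit,
          Matrix.one_apply_ne fun h0 : j = j' => hi (congrArg e h0.symm)]
        simp [c]
      · have : c j i = -(Ξ⁻¹ * ξ) j i := if_pos ⟨hiD, hir⟩
        rw [Matrix.add_apply, this, add_neg_cancel, zero_mul]
    · have : v i j = 0 := by
        by_contra h0
        exact hiD (hv i j h0)
      rw [this, mul_zero]
  · exact fun h0 => absurd (Finset.mem_univ _) h0

/-- A minimizing form on the reduced algebra extends by the normal pairing `g₁`, which bounds the
index from above. Conversely, a minimizing form on the large algebra is perturbed by a multiple of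
`g₁` to make its pairing invertible, and is then conjugated into normal form. -/
theorem relIndex_eq [Infinite K] (h : ReductionDatum r s s' D e)
    (hr : ∀ i j k, r i j → r j k → r i k) (hs' : ∀ i j k, s' i j → s' j k → s' i k) :
    relIndex K r hr = relIndex K s' hs' := by
  let g₁ : Module.Dual K (Matrix (γ ⊕ κ) (γ ⊕ κ) K) :=
    { toFun := fun M => ∑ j, M (.inr (e j)) (.inl j)
      map_add' := fun M N => by simp [Finset.sum_add_distrib]
      map_smul' := fun c M => by simp [Finset.mul_sum] }
  apply le_antisymm
  · obtain ⟨f, hf⟩ := exists_finrank_eq_lieIndex (K := K) (L := incidenceLie K s' hs')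
    obtain ⟨g, rfl⟩ := incidenceForm_surjective f
    let g₂ : Module.Dual K (Matrix (γ ⊕ κ) (γ ⊕ κ) K) :=
      { toFun := fun M => g M.toBlocks₂₂ + g₁ M
        map_add' := fun M N => by
          change g (M.toBlocks₂₂ + N.toBlocks₂₂) + _ = _
          rw [map_add, map_add]
          abel
        map_smul' := fun c M => by
          change g (c • M.toBlocks₂₂) + _ = _
          rw [map_smul, map_smul, RingHom.id_apply, smul_add] }
    have := h.finrank_stabilizer_normal hr hs' g₂ fun v _ => by
      change g 0 + ∑ j, v (e j) j = _
      rw [map_zero, zero_add]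
    refine (lieIndex_le _).trans (this.le.trans (le_of_eq ?_))
    have hform : incidenceForm r hr g₂ ∘ₗ (h.embed (K := K) hr hs').toLinearMap =
        incidenceForm s' hs' g := LinearMap.ext fun z => by
      change g z.1 + ∑ _ : γ, (0 : K) = g z.1
      simp
    rw [relIndex, ← hf, hform]
  · obtain ⟨f, hf⟩ := exists_finrank_eq_lieIndex (K := K) (L := incidenceLie K r hr)
    obtain ⟨g, rfl⟩ := incidenceForm_surjective f
    let Ξ : Matrix γ γ K := Matrix.of fun j j' : γ =>
      g (Matrix.fromBlocks 0 0 (Matrix.single (e j') j 1) 0)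
    -- The perturbed pairing is Ξ + t·1, whose determinant is the characteristic polynomial of -Ξ at
    -- t. Avoiding finitely many t keeps it invertible and the stabilizer no larger.
    obtain ⟨t, ht⟩ := ((finite_finrank_stabilizer_lt (incidenceForm r hr g)
      (incidenceForm r hr g₁)).union
      ((-Ξ).charpoly.rootSet_finite K)).infinite_compl.nonempty
    simp only [Set.mem_compl_iff, Set.mem_union, Set.mem_ofPred_eq, not_or, not_lt,
      Polynomial.mem_rootSet, not_and, Polynomial.coe_aeval_eq_eval] at ht
    have hdet := ht.2 (Matrix.charpoly_monic _).ne_zero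
    rw [Matrix.eval_charpoly] at hdet
    obtain ⟨g', hg', hfr⟩ := h.exists_normal hr (g + t • g₁) (by
      convert hdet using 2
      ext j j'
      have : g₁ (Matrix.fromBlocks 0 0 (Matrix.single (e j') j 1) 0) = if j = j' then 1 else 0 := by
        change ∑ i, (Matrix.single (e j') j (1 : K)) (e i) i = _
        rw [Finset.sum_eq_single j]
        · simp [Matrix.single_apply, h.inj.eq_iff, eq_comm]
        · intro b _ hb
          simp [Ne.symm hb]
        · simp
      simp only [Matrix.of_apply, LinearMap.add_apply, LinearMap.smul_apply, this]
      by_cases hj : j = j'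
      · simp [hj, Ξ, add_comm]
      · simp [hj, Ξ])
    rw [relIndex, relIndex, ← hf]
    refine le_trans ?_ ht.1
    have hadd : incidenceForm r hr (g + t • g₁) =
        incidenceForm r hr g + t • incidenceForm r hr g₁ := rfl
    rw [← hadd, ← hfr, h.finrank_stabilizer_normal hr hs' g' hg']
    exact lieIndex_le _

end ReductionDatum

end ReductionIndex

/-! ### Seaweed algebras of lists of parts and the two reduction rules -/

section Lists

/-- The positions `i` and `j` lie in the same block of the composition with parts `l`. -/
def SameBlock (l : List ℕ) (i j : ℕ) : Prop :=
  ∃ k, (l.take k).sum ≤ i ∧ i < (l.take (k + 1)).sum ∧ (l.take k).sum ≤ j ∧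
    j < (l.take (k + 1)).sum

theorem sameBlock_cons {p : ℕ} {l : List ℕ} {i j : ℕ} : SameBlock (p :: l) i j ↔
    (i < p ∧ j < p) ∨ (p ≤ i ∧ p ≤ j ∧ SameBlock l (i - p) (j - p)) := by
  constructor
  · rintro ⟨_ | k, h1, h2, h3, h4⟩
    · simp at h2 h4
      exact .inl ⟨h2, h4⟩
    · simp only [List.take_succ_cons, List.sum_cons] at h1 h2 h3 h4
      exact .inr ⟨by omega, by omega, k, by omega, by omega, by omega, by omega⟩
  · rintro (⟨h1, h2⟩ | ⟨h1, h2, k, h3, h4, h5, h6⟩)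
    · exact ⟨0, by simp, by simpa using h1, by simp, by simpa using h2⟩
    · refine ⟨k + 1, ?_⟩
      simp only [List.take_succ_cons, List.sum_cons]
      omega

theorem take_sum_mono (l : List ℕ) {k k' : ℕ} (h : k ≤ k') :
    (l.take k).sum ≤ (l.take k').sum := by
  obtain ⟨d, rfl⟩ := Nat.exists_eq_add_of_le h
  rw [List.take_add, List.sum_append]
  exact Nat.le_add_right _ _

theorem SameBlock.symm {l : List ℕ} {i j : ℕ} (h : SameBlock l i j) : SameBlock l j i := by
  obtain ⟨k, h1, h2, h3, h4⟩ := h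
  exact ⟨k, h3, h4, h1, h2⟩

theorem SameBlock.trans {l : List ℕ} {i j m : ℕ} (h : SameBlock l i j) (h' : SameBlock l j m) :
    SameBlock l i m := by
  obtain ⟨k, h1, h2, h3, h4⟩ := h
  obtain ⟨k', h1', h2', h3', h4'⟩ := h'
  have : k = k' := by
    rcases lt_trichotomy k k' with hk | hk | hk
    · have := take_sum_mono l (Nat.succ_le_of_lt hk)
      simp only [Nat.succ_eq_add_one] at this
      omega
    · exact hk
    · have := take_sum_mono l (Nat.succ_le_of_lt hk)
      simp only [Nat.succ_eq_add_one] at this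
      omega
  subst this
  exact ⟨k, h1, h2, h3', h4'⟩

theorem SameBlock.convex {l : List ℕ} {i j m : ℕ} (h : SameBlock l i j) (h1 : i ≤ m)
    (h2 : m ≤ j) : SameBlock l i m := by
  obtain ⟨k, h3, h4, h5, h6⟩ := h
  exact ⟨k, h3, h4, by omega, by omega⟩

/-- The relation of the seaweed algebra of two lists of parts, on natural numbers. -/
def SeaweedRel (a b : List ℕ) (i j : ℕ) : Prop :=
  (i < j → SameBlock a i j) ∧ (j < i → SameBlock b i j)

theorem SeaweedRel.swap {a b : List ℕ} {i j : ℕ} : SeaweedRel b a i j ↔ SeaweedRel a b j i :=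
  ⟨fun h => ⟨fun h' => (h.2 h').symm, fun h' => (h.1 h').symm⟩,
    fun h => ⟨fun h' => (h.2 h').symm, fun h' => (h.1 h').symm⟩⟩

theorem SeaweedRel.trans {a b : List ℕ} {i j m : ℕ} (h : SeaweedRel a b i j)
    (h' : SeaweedRel a b j m) : SeaweedRel a b i m := by
  have key : ∀ l i j m, i < m → (i < j → SameBlock l i j) → (j < m → SameBlock l j m) →
      SameBlock l i m := by
    intro l i j m him h h'
    rcases lt_trichotomy i j with hij | rfl | hij
    · rcases lt_trichotomy j m with hjm | rfl | hjm
      · exact (h hij).trans (h' hjm)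
      · exact h hij
      · exact (h hij).convex him.le hjm.le
    · exact h' him
    · exact ((h' (hij.trans him)).convex hij.le him.le).symm.trans (h' (hij.trans him))
  exact ⟨fun him => key a i j m him h.1 h'.1, fun hmi =>
    (key b m j i hmi (fun h0 => (h'.2 h0).symm) (fun h0 => (h.2 h0).symm)).symm⟩

theorem composition_index_eq_iff {n : ℕ} (a : Composition n) (i j : Fin n) :
    a.index i = a.index j ↔ SameBlock a.blocks i j := by
  have key : ∀ (i : Fin n) (k : ℕ), (a.blocks.take k).sum ≤ i → i < (a.blocks.take (k + 1)).sum →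
      (a.index i : ℕ) = k := by
    intro i k h1 h2
    have h3 := a.lt_sizeUpTo_index_succ i
    have h4 := a.sizeUpTo_index_le i
    simp only [Fin.val_succ, Composition.sizeUpTo] at h3 h4
    rcases lt_trichotomy (a.index i : ℕ) k with hk | hk | hk
    · have := take_sum_mono a.blocks (Nat.succ_le_of_lt hk)
      simp only [Nat.succ_eq_add_one] at this
      omega
    · exact hk
    · have := take_sum_mono a.blocks (Nat.succ_le_of_lt hk)
      simp only [Nat.succ_eq_add_one] at this
      omega
  constructor
  · intro h
    refine ⟨a.index i, a.sizeUpTo_index_le i, a.lt_sizeUpTo_index_succ i, ?_, ?_⟩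
    · rw [h]; exact a.sizeUpTo_index_le j
    · rw [h]; exact a.lt_sizeUpTo_index_succ j
  · rintro ⟨k, h1, h2, h3, h4⟩
    exact Fin.ext ((key i k h1 h2).trans (key j k h3 h4).symm)

/-- The index of the seaweed algebra in `𝔤𝔩ₙ(K)` of two lists of parts. -/
noncomputable def listIndex (K : Type*) [Field K] (n : ℕ) (a b : List ℕ) : ℕ :=
  relIndex K (fun i j : Fin n => SeaweedRel a b i j) fun _ _ _ h h' => h.trans h'

variable (K : Type*) [Field K]

theorem ind_eq_listIndex {n : ℕ} (m : Meander n) :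
    m.ind K = listIndex K n m.1.blocks m.2.blocks := by
  have h : seaweedAlgebra K m.1 m.2 = incidenceLie K
      (fun i j : Fin n => SeaweedRel m.1.blocks m.2.blocks i j) fun _ _ _ h h' => h.trans h' := by
    ext M
    refine forall_congr' fun i => forall_congr' fun j => imp_congr_right fun _ => ?_
    exact and_congr (imp_congr_right fun _ => composition_index_eq_iff _ _ _)
      (imp_congr_right fun _ => composition_index_eq_iff _ _ _)
  rw [Meander.ind, listIndex, relIndex, h]

theorem listIndex_swap (n : ℕ) (a b : List ℕ) : listIndex K n b a = listIndex K n a b := by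
  rw [listIndex, listIndex, ← relIndex_swap K (r := fun i j : Fin n => SeaweedRel a b i j)
    fun _ _ _ h h' => h.trans h']
  exact relIndex_congr K _ _ (Equiv.refl _) fun i j => SeaweedRel.swap

theorem listIndex_zero (a b : List ℕ) : listIndex K 0 a b = 0 := by
  refine Nat.le_zero.1 ((lieIndex_le 0).trans ?_)
  have : Subsingleton (Matrix (Fin 0) (Fin 0) K) := inferInstance
  exact (Module.finrank_zero_of_subsingleton).le

/-- A cut common to both compositions makes the algebra block diagonal, with first summand 𝔤𝔩_p. -/
theorem listIndex_cons_cons [CharZero K] (p n : ℕ) (a b : List ℕ) :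
    listIndex K (p + n) (p :: a) (p :: b) = p + listIndex K n a b := by
  have hL : ∀ i j : Fin p ⊕ Fin n, Sum.LiftRel (fun _ _ : Fin p => True)
      (fun i j : Fin n => SeaweedRel a b i j) i j ↔
      SeaweedRel (p :: a) (p :: b) (finSumFinEquiv i) (finSumFinEquiv j) := by
    rintro (i | i) (j | j)
    · simp [SeaweedRel, sameBlock_cons]
    · have := i.2
      simp [SeaweedRel, sameBlock_cons]
      omega
    · have := j.2
      simp [SeaweedRel, sameBlock_cons]
      omega
    · simp [SeaweedRel, sameBlock_cons]
  have hT : ∀ i j k : Fin p ⊕ Fin n, _ → _ → _ := fun i j k h h' =>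
    (hL i k).2 (((hL i j).1 h).trans ((hL j k).1 h'))
  rw [listIndex, ← relIndex_congr K hT _ finSumFinEquiv hL,
    relIndex_sum K (fun _ _ _ _ _ => trivial) (fun _ _ _ h h' => h.trans h') hT,
    relIndex_full p _ _ fun _ _ => trivial]
  rfl

/-- Here γ is the set of the first c nodes and D the remaining 2c nodes of the large block. Deleting
γ leaves a block of size 2c, and removing the positions from its second half to its first half cuts
it into c|c. -/
theorem listIndex_cons_three_mul_cons [CharZero K] {c n : ℕ} (a b : List ℕ) (hn : 2 * c ≤ n) :
    listIndex K (c + n) (c :: a) (3 * c :: b) = listIndex K n a (c :: c :: b) := by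
  let r : Fin c ⊕ Fin n → Fin c ⊕ Fin n → Prop := fun i j =>
    SeaweedRel (c :: a) (3 * c :: b) (finSumFinEquiv i) (finSumFinEquiv j)
  -- The copy of γ is the last third of the large block. It must be the last one: `full` needs the
  -- positions from it to the rest of D to lie below the diagonal.
  let e : Fin c → Fin n := fun j => ⟨c + j, by omega⟩
  have he : ∀ i : Fin n, i ∈ Set.range e ↔ c ≤ i ∧ i < 2 * c := fun i => by
    constructor
    · rintro ⟨j, rfl⟩
      simp only [e]
      omega
    · intro h
      exact ⟨⟨i - c, by omega⟩, Fin.ext (by simp only [e]; omega)⟩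
  have hR : ReductionDatum r (fun i j : Fin n => SeaweedRel a (2 * c :: b) i j)
      (fun i j : Fin n => SeaweedRel a (c :: c :: b) i j) (fun i => (i : ℕ) < 2 * c) e :=
    { inj := fun i j hij => by
        have := congrArg Fin.val hij
        exact Fin.ext (by simpa [e] using this)
      refl := fun i => ⟨fun h => absurd h (lt_irrefl _), fun h => absurd h (lt_irrefl _)⟩
      lower := fun k i h hi => by
        by_contra hk
        have := h.2 (by omega)
        rw [sameBlock_cons] at this
        omega
      mem := fun j => by simp only [e]; omega
      full := fun j i hi hi' => by
        rw [he] at hi'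
        refine ⟨fun h => ?_, fun h => ?_⟩
        · simp only [e] at h; omega
        · rw [sameBlock_cons]; simp only [e] at h ⊢; omega
      inl_inl := fun i j => by
        simp only [r, SeaweedRel, sameBlock_cons, finSumFinEquiv_apply_left, Fin.val_castAdd]
        omega
      inl_inr := fun i j => by
        simp only [r, SeaweedRel, sameBlock_cons, finSumFinEquiv_apply_left, Fin.val_castAdd,
          finSumFinEquiv_apply_right, Fin.val_natAdd]
        omega
      inr_inl := fun i j => by
        simp only [r, SeaweedRel, sameBlock_cons, finSumFinEquiv_apply_left, Fin.val_castAdd,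
          finSumFinEquiv_apply_right, Fin.val_natAdd]
        omega
      inr_inr := fun i j => by
        simp only [r, SeaweedRel, sameBlock_cons, finSumFinEquiv_apply_right, Fin.val_natAdd]
        have h1 : c + (i : ℕ) - 3 * c = i - 2 * c := by omega
        have h2 : c + (j : ℕ) - 3 * c = j - 2 * c := by omega
        rw [h1, h2, Nat.add_sub_cancel_left, Nat.add_sub_cancel_left]
        refine and_congr ?_ ?_
        · refine imp_congr (by omega) ?_
          simp
        · refine imp_congr (by omega) (or_congr (by omega) (and_congr (by omega)
            (and_congr_left fun _ => by omega)))
      reduced := fun i j => by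
        rw [he, he]
        simp only [SeaweedRel, sameBlock_cons]
        have h1 : (i : ℕ) - c - c = i - 2 * c := by omega
        have h2 : (j : ℕ) - c - c = j - 2 * c := by omega
        rw [h1, h2]
        by_cases hs : SameBlock b (i - 2 * c) (j - 2 * c)
        · simp only [hs, and_true]
          by_cases ha : SameBlock a i j
          · simp only [ha, implies_true, true_and]
            omega
          · simp only [ha, imp_false]
            omega
        · simp only [hs, and_false, or_false]
          by_cases ha : SameBlock a i j
          · simp only [ha, implies_true, true_and]
            omega
          · simp only [ha, imp_false]
            omega }
  rw [listIndex, listIndex, ← hR.relIndex_eq (K := K) (fun _ _ _ h h' => h.trans h')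
    fun _ _ _ h h' => h.trans h']
  exact (relIndex_congr K _ _ finSumFinEquiv fun _ _ => Iff.rfl).symm

end Lists

/-! ### Lists with entries 1 and 3, and sums over pairs of them -/

section OneThreeLists

/-- The lists with entries in `{1, 3}` and sum `n`. -/
def oneThreeLists : ℕ → Finset (List ℕ)
  | 0 => {[]}
  | 1 => {[1]}
  | 2 => {[1, 1]}
  | n + 3 => (oneThreeLists (n + 2)).image (List.cons 1) ∪ (oneThreeLists n).image (List.cons 3)

theorem cons_mem_oneThreeLists {p n : ℕ} {l : List ℕ} : p :: l ∈ oneThreeLists n ↔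
    (p = 1 ∨ p = 3) ∧ ∃ m, n = p + m ∧ l ∈ oneThreeLists m := by
  rcases n with _ | _ | _ | n
  · simp only [oneThreeLists]
    simp
    omega
  · simp only [oneThreeLists]
    constructor
    · intro h
      obtain ⟨rfl, rfl⟩ : p = 1 ∧ l = [] := by simpa using h
      exact ⟨.inl rfl, 0, rfl, by simp [oneThreeLists]⟩
    · rintro ⟨rfl | rfl, m, hm, hl⟩
      · obtain rfl : m = 0 := by omega
        simpa [oneThreeLists] using hl
      · omega
  · simp only [oneThreeLists]
    constructor
    · intro h
      obtain ⟨rfl, rfl⟩ : p = 1 ∧ l = [1] := by simpa using h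
      exact ⟨.inl rfl, 1, rfl, by simp [oneThreeLists]⟩
    · rintro ⟨rfl | rfl, m, hm, hl⟩
      · obtain rfl : m = 1 := by omega
        simpa [oneThreeLists] using hl
      · omega
  · simp only [oneThreeLists, Finset.mem_union, Finset.mem_image, List.cons.injEq]
    constructor
    · rintro (⟨a, ha, rfl, rfl⟩ | ⟨a, ha, rfl, rfl⟩)
      · exact ⟨.inl rfl, n + 2, by omega, ha⟩
      · exact ⟨.inr rfl, n, by omega, ha⟩
    · rintro ⟨rfl | rfl, m, hm, hl⟩
      · obtain rfl : m = n + 2 := by omega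
        exact .inl ⟨l, hl, rfl, rfl⟩
      · obtain rfl : m = n := by omega
        exact .inr ⟨l, hl, rfl, rfl⟩

theorem nil_mem_oneThreeLists {n : ℕ} : [] ∈ oneThreeLists n ↔ n = 0 := by
  rcases n with _ | _ | _ | n <;> simp [oneThreeLists]

theorem mem_oneThreeLists {l : List ℕ} {n : ℕ} :
    l ∈ oneThreeLists n ↔ (∀ p ∈ l, p = 1 ∨ p = 3) ∧ l.sum = n := by
  induction l generalizing n with
  | nil => simp [nil_mem_oneThreeLists, eq_comm]
  | cons p l ih =>
    rw [cons_mem_oneThreeLists]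
    simp only [ih, List.mem_cons, forall_eq_or_imp, List.sum_cons]
    constructor
    · rintro ⟨h1, m, rfl, h2, rfl⟩
      exact ⟨⟨h1, h2⟩, rfl⟩
    · rintro ⟨⟨h1, h2⟩, rfl⟩
      exact ⟨h1, _, rfl, h2, rfl⟩

theorem sum_of_mem_oneThreeLists {l : List ℕ} {n : ℕ} (h : l ∈ oneThreeLists n) : l.sum = n :=
  (mem_oneThreeLists.1 h).2

variable {M : Type*} [AddCommMonoid M]

theorem sum_oneThreeLists_add_three (n : ℕ) (g : List ℕ → M) :
    ∑ a ∈ oneThreeLists (n + 3), g a =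
      ∑ a ∈ oneThreeLists (n + 2), g (1 :: a) + ∑ a ∈ oneThreeLists n, g (3 :: a) := by
  rw [oneThreeLists, Finset.sum_union, Finset.sum_image, Finset.sum_image]
  · exact fun _ _ _ _ h => List.cons_injective h
  · exact fun _ _ _ _ h => List.cons_injective h
  · rw [Finset.disjoint_left]
    simp

theorem sum_oneThreeLists_one (g : List ℕ → M) :
    ∑ a ∈ oneThreeLists 1, g a = ∑ a ∈ oneThreeLists 0, g (1 :: a) := by
  simp [oneThreeLists]

theorem sum_oneThreeLists_two (g : List ℕ → M) :
    ∑ a ∈ oneThreeLists 2, g a = ∑ a ∈ oneThreeLists 1, g (1 :: a) := by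
  simp [oneThreeLists]

/-- The sum of `g` over the pairs of lists with entries in `{1, 3}` and sums `m` and `n`. -/
def pairSum (m n : ℕ) (g : List ℕ → List ℕ → M) : M :=
  ∑ a ∈ oneThreeLists m, ∑ b ∈ oneThreeLists n, g a b

theorem pairSum_swap (m n : ℕ) (g : List ℕ → List ℕ → M) :
    pairSum m n (fun a b => g b a) = pairSum n m g := Finset.sum_comm

theorem pairSum_congr {m n : ℕ} {g g' : List ℕ → List ℕ → M}
    (h : ∀ a ∈ oneThreeLists m, ∀ b ∈ oneThreeLists n, g a b = g' a b) :
    pairSum m n g = pairSum m n g' :=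
  Finset.sum_congr rfl fun a ha => Finset.sum_congr rfl fun b hb => h a ha b hb

theorem pairSum_add_three_left (m n : ℕ) (g : List ℕ → List ℕ → M) : pairSum (m + 3) n g =
    pairSum (m + 2) n (fun a b => g (1 :: a) b) + pairSum m n fun a b => g (3 :: a) b :=
  sum_oneThreeLists_add_three _ _

theorem pairSum_one_left (n : ℕ) (g : List ℕ → List ℕ → M) :
    pairSum 1 n g = pairSum 0 n fun a b => g (1 :: a) b := sum_oneThreeLists_one _

theorem pairSum_two_left (n : ℕ) (g : List ℕ → List ℕ → M) :
    pairSum 2 n g = pairSum 1 n fun a b => g (1 :: a) b := sum_oneThreeLists_two _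

theorem pairSum_add_three_right (m n : ℕ) (g : List ℕ → List ℕ → M) : pairSum m (n + 3) g =
    pairSum m (n + 2) (fun a b => g a (1 :: b)) + pairSum m n fun a b => g a (3 :: b) := by
  rw [← pairSum_swap, pairSum_add_three_left, pairSum_swap _ _ fun a b => g a (1 :: b),
    pairSum_swap _ _ fun a b => g a (3 :: b)]

theorem pairSum_one_right (m : ℕ) (g : List ℕ → List ℕ → M) :
    pairSum m 1 g = pairSum m 0 fun a b => g a (1 :: b) := by
  rw [← pairSum_swap, pairSum_one_left, pairSum_swap _ _ fun a b => g a (1 :: b)]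

theorem pairSum_two_right (m : ℕ) (g : List ℕ → List ℕ → M) :
    pairSum m 2 g = pairSum m 1 fun a b => g a (1 :: b) := by
  rw [← pairSum_swap, pairSum_two_left, pairSum_swap _ _ fun a b => g a (1 :: b)]

end OneThreeLists

/-! ### Recursions for sums of weights -/

section Weights

open Polynomial

/-- Weights of pairs of lists which obey the rules of the reduction: `F` is the weight of a pair,
`F₂` and `F₁` the weights of pairs the second of which begins with the remaining part `2` or `1` of
a part `3`, and `φ` the weight of what follows a common partial sum. -/
structure ReductionWeight (F F₁ F₂ φ : List ℕ → List ℕ → ℚ[X]) : Prop where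
  one_one : ∀ n, ∀ a ∈ oneThreeLists n, ∀ b ∈ oneThreeLists n, F (1 :: a) (1 :: b) = X * φ a b
  three_three : ∀ n, ∀ a ∈ oneThreeLists n, ∀ b ∈ oneThreeLists n,
    F (3 :: a) (3 :: b) = X ^ 3 * φ a b
  one_three : ∀ n, ∀ a ∈ oneThreeLists (n + 2), ∀ b ∈ oneThreeLists n,
    F (1 :: a) (3 :: b) = F₂ a b
  three_one : ∀ n, ∀ a ∈ oneThreeLists n, ∀ b ∈ oneThreeLists (n + 2),
    F (3 :: a) (1 :: b) = F₂ b a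
  two_one : ∀ n, ∀ a ∈ oneThreeLists (n + 1), ∀ b ∈ oneThreeLists n, F₂ (1 :: a) b = X * F₁ a b
  two_three : ∀ n, ∀ a ∈ oneThreeLists n, ∀ b ∈ oneThreeLists (n + 1), F₂ (3 :: a) b = X * F₁ b a
  rest_one : ∀ n, ∀ a ∈ oneThreeLists n, ∀ b ∈ oneThreeLists n, F₁ (1 :: a) b = X * φ a b
  rest_three : ∀ n, ∀ a ∈ oneThreeLists n, ∀ b ∈ oneThreeLists (n + 2), F₁ (3 :: a) b = F₂ b a

namespace ReductionWeight

theorem pairSum_mul (m n : ℕ) (p : ℚ[X]) (g : List ℕ → List ℕ → ℚ[X]) :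
    pairSum m n (fun a b => p * g a b) = p * pairSum m n g := by
  simp [pairSum, Finset.mul_sum]

variable {F F₁ F₂ φ : List ℕ → List ℕ → ℚ[X]}

theorem sum_one (h : ReductionWeight F F₁ F₂ φ) : pairSum 1 1 F = X * pairSum 0 0 φ := by
  rw [pairSum_one_left, pairSum_one_right, pairSum_congr (h.one_one 0), pairSum_mul]

theorem sum_two (h : ReductionWeight F F₁ F₂ φ) : pairSum 2 2 F = X * pairSum 1 1 φ := by
  rw [pairSum_two_left, pairSum_two_right, pairSum_congr (h.one_one 1), pairSum_mul]

/-- The four terms are the four choices of first parts; the two mixed choices are mirror images and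
give the factor 2. -/
theorem sum_add_three (h : ReductionWeight F F₁ F₂ φ) (n : ℕ) : pairSum (n + 3) (n + 3) F =
    X * pairSum (n + 2) (n + 2) φ + X ^ 3 * pairSum n n φ + 2 * pairSum (n + 2) n F₂ := by
  rw [pairSum_add_three_left, pairSum_add_three_right, pairSum_add_three_right,
    pairSum_congr (h.one_one (n + 2)), pairSum_congr (h.three_three n),
    pairSum_congr (h.one_three n), pairSum_congr (h.three_one n), pairSum_mul, pairSum_mul,
    pairSum_swap n (n + 2) F₂]
  ring

theorem sum_two_zero (h : ReductionWeight F F₁ F₂ φ) : pairSum 2 0 F₂ = X * pairSum 1 0 F₁ := by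
  rw [pairSum_two_left, pairSum_congr (h.two_one 0), pairSum_mul]

theorem sum_two_succ (h : ReductionWeight F F₁ F₂ φ) (n : ℕ) : pairSum (n + 3) (n + 1) F₂ =
    X * pairSum (n + 2) (n + 1) F₁ + X * pairSum (n + 1) n F₁ := by
  rw [pairSum_add_three_left, pairSum_congr (h.two_one (n + 1)), pairSum_congr (h.two_three n),
    pairSum_mul, pairSum_mul, pairSum_swap n (n + 1) F₁]

theorem sum_rest_zero (h : ReductionWeight F F₁ F₂ φ) : pairSum 1 0 F₁ = X * pairSum 0 0 φ := by
  rw [pairSum_one_left, pairSum_congr (h.rest_one 0), pairSum_mul]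

theorem sum_rest_one (h : ReductionWeight F F₁ F₂ φ) : pairSum 2 1 F₁ = X * pairSum 1 1 φ := by
  rw [pairSum_two_left, pairSum_congr (h.rest_one 1), pairSum_mul]

theorem sum_rest_add_two (h : ReductionWeight F F₁ F₂ φ) (n : ℕ) : pairSum (n + 3) (n + 2) F₁ =
    X * pairSum (n + 2) (n + 2) φ + pairSum (n + 2) n F₂ := by
  rw [pairSum_add_three_left, pairSum_congr (h.rest_one (n + 2)), pairSum_congr (h.rest_three n),
    pairSum_mul, pairSum_swap n (n + 2) F₂]

end ReductionWeight

end Weights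

/-! ### Indecomposability as absence of common partial sums -/

section Irreducible

/-- `s` is a partial sum of `l`. -/
def IsCut (l : List ℕ) (s : ℕ) : Prop := ∃ k, (l.take k).sum = s

theorem isCut_cons {p : ℕ} {l : List ℕ} {s : ℕ} :
    IsCut (p :: l) s ↔ s = 0 ∨ ∃ s', IsCut l s' ∧ s = p + s' := by
  constructor
  · rintro ⟨_ | k, rfl⟩
    · exact .inl (by simp)
    · exact .inr ⟨_, ⟨k, rfl⟩, by simp⟩
  · rintro (rfl | ⟨s', ⟨k, rfl⟩, rfl⟩)
    · exact ⟨0, by simp⟩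
    · exact ⟨k + 1, by simp⟩

theorem isCut_zero (l : List ℕ) : IsCut l 0 := ⟨0, by simp⟩

/-- The lists `a` and `b` have no common partial sum strictly between `0` and `n`. -/
def NoCommonCut (n : ℕ) (a b : List ℕ) : Prop :=
  0 < n ∧ ∀ s, 0 < s → s < n → IsCut a s → ¬ IsCut b s

theorem noCommonCut_swap {n : ℕ} {a b : List ℕ} : NoCommonCut n b a ↔ NoCommonCut n a b :=
  ⟨fun h => ⟨h.1, fun s h1 h2 h3 h4 => h.2 s h1 h2 h4 h3⟩,
    fun h => ⟨h.1, fun s h1 h2 h3 h4 => h.2 s h1 h2 h4 h3⟩⟩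

theorem noCommonCut_cons_self {p n : ℕ} (hp : 0 < p) (a b : List ℕ) :
    NoCommonCut (p + n) (p :: a) (p :: b) ↔ n = 0 := by
  constructor
  · intro h
    by_contra h0
    exact h.2 p hp (by omega) (isCut_cons.2 (.inr ⟨0, isCut_zero a, rfl⟩))
      (isCut_cons.2 (.inr ⟨0, isCut_zero b, rfl⟩))
  · rintro rfl
    refine ⟨hp, fun s h1 h2 h3 => ?_⟩
    rcases isCut_cons.1 h3 with h | ⟨s', -, h⟩ <;> omega

/-- Any positive partial sum of the second list is at least p + q, so p itself is never a common
cut, and the other cuts shift by p. -/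
theorem noCommonCut_cons_add {p q n : ℕ} (hp : 0 < p) (hq : 0 < q) (hn : 0 < n) (a b : List ℕ) :
    NoCommonCut (p + n) (p :: a) ((p + q) :: b) ↔ NoCommonCut n a (q :: b) := by
  constructor
  · refine fun h => ⟨hn, fun s h1 h2 h3 h4 => ?_⟩
    rcases isCut_cons.1 h4 with h0 | ⟨s', hs', h0⟩
    · omega
    · exact h.2 (p + s) (by omega) (by omega) (isCut_cons.2 (.inr ⟨s, h3, rfl⟩))
        (isCut_cons.2 (.inr ⟨s', hs', by omega⟩))
  · refine fun h => ⟨by omega, fun s h1 h2 h3 h4 => ?_⟩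
    rcases isCut_cons.1 h3 with h0 | ⟨s₁, hs₁, h0⟩
    · omega
    · rcases isCut_cons.1 h4 with h0' | ⟨s₂, hs₂, h0'⟩
      · omega
      · exact h.2 s₁ (by omega) (by omega) hs₁ (isCut_cons.2 (.inr ⟨s₂, hs₂, by omega⟩))

theorem indecomposable_iff_noCommonCut {n : ℕ} (m : Meander n) :
    m.Indecomposable ↔ NoCommonCut n m.1.blocks m.2.blocks := by
  refine and_congr_right fun hn => ?_
  constructor
  · rintro h s h1 h2 ⟨k, hk⟩ ⟨k', hk'⟩
    have hdrop : ∀ (c : Composition n) (k : ℕ), (c.blocks.take k).sum = s →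
        (c.blocks.drop k).sum = n - s := by
      intro c k hk
      have h3 := congrArg List.sum (List.take_append_drop k c.blocks)
      rw [List.sum_append, c.blocks_sum] at h3
      omega
    refine h ⟨s, n - s, h2, by omega,
      (⟨m.1.blocks.take k, fun hi => m.1.blocks_pos (List.mem_of_mem_take hi), hk⟩,
        ⟨m.2.blocks.take k', fun hi => m.2.blocks_pos (List.mem_of_mem_take hi), hk'⟩),
      (⟨m.1.blocks.drop k, fun hi => m.1.blocks_pos (List.mem_of_mem_drop hi), hdrop _ _ hk⟩,
        ⟨m.2.blocks.drop k', fun hi => m.2.blocks_pos (List.mem_of_mem_drop hi), hdrop _ _ hk'⟩),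
      ?_, ?_⟩
    · exact (List.take_append_drop _ _).symm
    · exact (List.take_append_drop _ _).symm
  · rintro h ⟨n₁, n₂, h1, h2, m₁, m₂, h3, h4⟩
    have h5 := congrArg List.sum h3
    rw [List.sum_append, m.1.blocks_sum, m₁.1.blocks_sum, m₂.1.blocks_sum] at h5
    refine h n₁ (by omega) h1 ⟨m₁.1.blocks.length, ?_⟩ ⟨m₁.2.blocks.length, ?_⟩
    · rw [h3, List.take_left, m₁.1.blocks_sum]
    · rw [h4, List.take_left, m₁.2.blocks_sum]

end Irreducible

/-! ### The index of lists: scaling and weights -/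

section ListIndex

variable (K : Type*) [Field K] [CharZero K]

theorem listIndex_three_mul_cons_cons {c m n : ℕ} (a b : List ℕ) (hn : 2 * c ≤ n)
    (hm : m = c + n) : listIndex K m (3 * c :: a) (c :: b) = listIndex K n b (c :: c :: a) := by
  rw [hm, ← listIndex_swap, listIndex_cons_three_mul_cons K b a hn]

/-- Both reduction rules hold for every c and keep the unscaled parts in {1, 3}, so the scaled and
unscaled pairs reduce in parallel; equal first parts p contribute cp and p. -/
theorem listIndex_map_mul {n : ℕ} (c : ℕ) : ∀ {a b : List ℕ}, a ∈ oneThreeLists n →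
    b ∈ oneThreeLists n → listIndex K (c * n) (a.map (c * ·)) (b.map (c * ·)) =
      c * listIndex K n a b := by
  induction n using Nat.strong_induction_on with
  | _ n ih =>
    intro a b ha hb
    rcases a with _ | ⟨p, a⟩
    · obtain rfl := nil_mem_oneThreeLists.1 ha
      rw [mul_zero, listIndex_zero, listIndex_zero, mul_zero]
    rcases b with _ | ⟨q, b⟩
    · obtain rfl := nil_mem_oneThreeLists.1 hb
      rw [mul_zero, listIndex_zero, listIndex_zero, mul_zero]
    have key : ∀ {a b : List ℕ} {m m' : ℕ}, n = 1 + m → n = 3 + m' → a ∈ oneThreeLists m →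
        b ∈ oneThreeLists m' →
        listIndex K (c * n) ((1 :: a).map (c * ·)) ((3 :: b).map (c * ·)) =
          c * listIndex K n (1 :: a) (3 :: b) := by
      intro a b m m' hm hm' ha hb
      have h1 := listIndex_cons_three_mul_cons K (c := c) (n := c * m) (a.map (c * ·))
        (b.map (c * ·)) (by rw [mul_comm]; exact Nat.mul_le_mul_left c (by omega))
      have h2 := listIndex_cons_three_mul_cons K (c := 1) (n := m) a b (by omega)
      have h3 := ih m (by omega) ha (b := 1 :: 1 :: b) (by
        rw [cons_mem_oneThreeLists]
        refine ⟨.inl rfl, 1 + m', by omega, ?_⟩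
        rw [cons_mem_oneThreeLists]
        exact ⟨.inl rfl, m', rfl, hb⟩)
      simp only [List.map_cons, mul_one] at h2 h3 ⊢
      rw [hm, h2, mul_add, mul_one, mul_comm c 3, h1, h3]
    obtain ⟨rfl | rfl, m, hm, ha⟩ := cons_mem_oneThreeLists.1 ha <;>
    obtain ⟨rfl | rfl, m', hm', hb⟩ := cons_mem_oneThreeLists.1 hb
    · obtain rfl : m = m' := by omega
      rw [List.map_cons, List.map_cons, hm, mul_add, mul_one, listIndex_cons_cons,
        listIndex_cons_cons, ih m (by omega) ha hb, mul_add, mul_one]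
    · exact key hm hm' ha hb
    · rw [← listIndex_swap, key hm' hm hb ha, listIndex_swap]
    · obtain rfl : m = m' := by omega
      rw [List.map_cons, List.map_cons, hm, mul_add, listIndex_cons_cons,
        listIndex_cons_cons, ih m (by omega) ha hb, mul_add]

open Polynomial

/-- After deleting the node opposite a part 3, the remaining 2 acts on the index as 1|1. This is why
the weight `F₂` prepends two ones. -/
theorem reductionWeight_index : ReductionWeight
    (fun a b => X ^ listIndex K a.sum a b) (fun a b => X ^ listIndex K a.sum a (1 :: b))
    (fun a b => X ^ listIndex K a.sum a (1 :: 1 :: b)) (fun a b => X ^ listIndex K a.sum a b) where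
  one_one n a ha b hb := by
    rw [List.sum_cons, listIndex_cons_cons, pow_add, pow_one]
  three_three n a ha b hb := by
    rw [List.sum_cons, listIndex_cons_cons, pow_add]
  one_three n a ha b hb := by
    have := sum_of_mem_oneThreeLists ha
    rw [List.sum_cons, ← listIndex_cons_three_mul_cons K a b (by omega), mul_one]
  three_one n a ha b hb := by
    have h1 := sum_of_mem_oneThreeLists ha
    have h2 := sum_of_mem_oneThreeLists hb
    rw [List.sum_cons, ← listIndex_three_mul_cons_cons K a b (by omega) (m := 3 + a.sum)
      (by omega), mul_one]
  two_one n a ha b hb := by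
    rw [List.sum_cons, listIndex_cons_cons, pow_add, pow_one]
  two_three n a ha b hb := by
    have h1 := sum_of_mem_oneThreeLists ha
    have h2 := sum_of_mem_oneThreeLists hb
    have h3 := listIndex_three_mul_cons_cons K (c := 1) a (1 :: b) (m := 3 + a.sum)
      (n := 1 + b.sum) (by omega) (by omega)
    rw [mul_one] at h3
    rw [List.sum_cons, h3, listIndex_cons_cons, pow_add, pow_one]
  rest_one n a ha b hb := by
    rw [List.sum_cons, listIndex_cons_cons, pow_add, pow_one]
  rest_three n a ha b hb := by
    have h1 := sum_of_mem_oneThreeLists ha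
    have h2 := sum_of_mem_oneThreeLists hb
    rw [List.sum_cons, ← listIndex_three_mul_cons_cons K a b (by omega) (m := 3 + a.sum)
      (by omega), mul_one]

-- For cuts, in contrast to the index, the rest of a part 3 is still a single part: the condition in
-- `F₂` prepends 2 while the index prepends 1|1. After a common cut only the empty pair is allowed,
-- so φ is the indicator of sum 0.
open Classical in
theorem reductionWeight_noCommonCut : ReductionWeight
    (fun a b => if NoCommonCut a.sum a b then X ^ listIndex K a.sum a b else 0)
    (fun a b => if NoCommonCut a.sum a (1 :: b) then X ^ listIndex K a.sum a (1 :: b) else 0)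
    (fun a b => if NoCommonCut a.sum a (2 :: b) then X ^ listIndex K a.sum a (1 :: 1 :: b) else 0)
    (fun a _ => if a.sum = 0 then 1 else 0) where
  one_one n a ha b hb := by
    rw [List.sum_cons, listIndex_cons_cons, pow_add, pow_one, noCommonCut_cons_self one_pos]
    by_cases h : a.sum = 0
    · rw [if_pos h, if_pos h, h, listIndex_zero, pow_zero]
    · rw [if_neg h, if_neg h, mul_zero]
  three_three n a ha b hb := by
    rw [List.sum_cons, listIndex_cons_cons, pow_add, noCommonCut_cons_self three_pos]
    by_cases h : a.sum = 0
    · rw [if_pos h, if_pos h, h, listIndex_zero, pow_zero]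
    · rw [if_neg h, if_neg h, mul_zero]
  one_three n a ha b hb := by
    have := sum_of_mem_oneThreeLists ha
    rw [(reductionWeight_index K).one_three n a ha b hb, List.sum_cons,
      noCommonCut_cons_add (q := 2) one_pos two_pos (by omega)]
  three_one n a ha b hb := by
    have h1 := sum_of_mem_oneThreeLists ha
    have h2 := sum_of_mem_oneThreeLists hb
    have h3 : (3 :: a).sum = 1 + b.sum := by rw [List.sum_cons]; omega
    rw [(reductionWeight_index K).three_one n a ha b hb, h3, ← noCommonCut_swap,
      noCommonCut_cons_add (q := 2) one_pos two_pos (by omega)]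
  two_one n a ha b hb := by
    have := sum_of_mem_oneThreeLists ha
    rw [(reductionWeight_index K).two_one n a ha b hb, List.sum_cons,
      noCommonCut_cons_add (p := 1) (q := 1) one_pos one_pos (by omega), mul_ite, mul_zero]
  two_three n a ha b hb := by
    have h1 := sum_of_mem_oneThreeLists ha
    have h2 := sum_of_mem_oneThreeLists hb
    have h3 : (3 :: a).sum = 2 + b.sum := by rw [List.sum_cons]; omega
    rw [(reductionWeight_index K).two_three n a ha b hb, h3, ← noCommonCut_swap,
      noCommonCut_cons_add (q := 1) two_pos one_pos (by omega), mul_ite, mul_zero]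
  rest_one n a ha b hb := by
    rw [List.sum_cons, listIndex_cons_cons, pow_add, pow_one, noCommonCut_cons_self one_pos]
    by_cases h : a.sum = 0
    · rw [if_pos h, if_pos h, h, listIndex_zero, pow_zero]
    · rw [if_neg h, if_neg h, mul_zero]
  rest_three n a ha b hb := by
    have h1 := sum_of_mem_oneThreeLists ha
    have h2 := sum_of_mem_oneThreeLists hb
    have h3 : (3 :: a).sum = 1 + b.sum := by rw [List.sum_cons]; omega
    rw [(reductionWeight_index K).rest_three n a ha b hb, h3, ← noCommonCut_swap,
      noCommonCut_cons_add (q := 2) one_pos two_pos (by omega)]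

end ListIndex

/-! ### Counts as coefficients, and the recurrence for indecomposable meanders -/

section Counting

open Polynomial

variable (K : Type*) [Field K]

theorem partsIn_one_three_iff {n : ℕ} (m : Meander n) :
    m.PartsIn {1, 3} ↔ m.1.blocks ∈ oneThreeLists n ∧ m.2.blocks ∈ oneThreeLists n := by
  simp only [mem_oneThreeLists, m.1.blocks_sum, m.2.blocks_sum, and_true]
  rfl

-- The predicate `Q` allows one argument for both counts: it is trivial for all meanders and
-- `NoCommonCut` for the indecomposable ones.
open Classical in
theorem ncard_eq_coeff_pairSum (n k : ℕ) (Q : ℕ → List ℕ → List ℕ → Prop) :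
    ((Set.ncard {m : Meander n | Q n m.1.blocks m.2.blocks ∧ m.PartsIn {1, 3} ∧ m.ind K = k} : ℕ) :
      ℚ) = (pairSum n n fun a b =>
        if Q a.sum a b then (X : ℚ[X]) ^ listIndex K a.sum a b else 0).coeff k := by
  have hinj : Function.Injective fun m : Meander n => (m.1.blocks, m.2.blocks) := by
    rintro ⟨a, b⟩ ⟨a', b'⟩ h
    obtain ⟨h1, h2⟩ := Prod.mk.inj h
    exact Prod.ext (Composition.ext h1) (Composition.ext h2)
  have himage : (fun m : Meander n => (m.1.blocks, m.2.blocks)) ''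
      {m : Meander n | Q n m.1.blocks m.2.blocks ∧ m.PartsIn {1, 3} ∧ m.ind K = k} =
      ↑((oneThreeLists n ×ˢ oneThreeLists n).filter fun ab =>
        Q n ab.1 ab.2 ∧ listIndex K n ab.1 ab.2 = k) := by
    ext ⟨a, b⟩
    simp only [Set.mem_image, Set.mem_ofPred_eq, Finset.coe_filter, Finset.mem_product,
      partsIn_one_three_iff, ind_eq_listIndex, Prod.mk.injEq]
    constructor
    · rintro ⟨m, ⟨h1, h2, h3⟩, rfl, rfl⟩
      exact ⟨h2, h1, h3⟩
    · rintro ⟨⟨h1, h2⟩, h3, h4⟩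
      have hpos : ∀ {l : List ℕ}, l ∈ oneThreeLists n → ∀ {i}, i ∈ l → 0 < i := by
        intro l hl i hi
        rcases (mem_oneThreeLists.1 hl).1 i hi with h | h <;> omega
      exact ⟨(⟨a, hpos h1, sum_of_mem_oneThreeLists h1⟩, ⟨b, hpos h2, sum_of_mem_oneThreeLists h2⟩),
        ⟨h3, ⟨h1, h2⟩, h4⟩, rfl, rfl⟩
  rw [← Set.ncard_image_of_injective _ hinj, himage, Set.ncard_coe_finset, Finset.card_filter,
    Nat.cast_sum, pairSum, Polynomial.finsetSum_coeff, Finset.sum_product]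
  refine Finset.sum_congr rfl fun a ha => ?_
  rw [Polynomial.finsetSum_coeff]
  refine Finset.sum_congr rfl fun b hb => ?_
  rw [sum_of_mem_oneThreeLists ha]
  by_cases h : Q n a b
  · simp [h, coeff_X_pow, eq_comm]
  · simp [h]

theorem meanderCount_eq_coeff (n k : ℕ) : (meanderCount K {1, 3} n k : ℚ) =
    (pairSum n n fun a b => (X : ℚ[X]) ^ listIndex K a.sum a b).coeff k := by
  have := ncard_eq_coeff_pairSum K n k fun _ _ _ => True
  simpa [meanderCount] using this

open Classical in
theorem indecomposableCount_eq_coeff (n k : ℕ) : (indecomposableCount K {1, 3} n k : ℚ) =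
    (pairSum n n fun a b =>
      if NoCommonCut a.sum a b then (X : ℚ[X]) ^ listIndex K a.sum a b else 0).coeff k := by
  rw [← ncard_eq_coeff_pairSum]
  simp only [indecomposableCount, indecomposable_iff_noCommonCut]

/-- With φ zero in positive degree, i_{n+7} is twice a sum of type `F₂`, and two further steps turn
that into y times such sums for n + 5 and n + 4. The shift by 7 keeps every term at 4 or above; i_3
has the extra summand y³ from the pair (3), (3). -/
theorem indecomposableCount_add_seven [CharZero K] (n k : ℕ) :
    indecomposableCount K {1, 3} (n + 7) (k + 1) =
      indecomposableCount K {1, 3} (n + 5) k + indecomposableCount K {1, 3} (n + 4) k := by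
  classical
  have h := reductionWeight_noCommonCut K
  have hφ : ∀ n, pairSum (n + 1) (n + 1) (fun a _ => if a.sum = 0 then (1 : ℚ[X]) else 0) = 0 := by
    intro n
    rw [pairSum_congr (g' := fun _ _ => 0)]
    · simp [pairSum]
    · intro a ha b _
      rw [sum_of_mem_oneThreeLists ha, if_neg (Nat.succ_ne_zero n)]
  have hF := fun n => h.sum_add_three (n + 1)
  have hF₂ := fun n => h.sum_two_succ (n + 2)
  have hF₁ := fun n => h.sum_rest_add_two n
  simp only [hφ, mul_zero, zero_add, add_assoc, Nat.reduceAdd] at hF hF₂ hF₁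
  rw [← Nat.cast_inj (R := ℚ), Nat.cast_add, indecomposableCount_eq_coeff,
    indecomposableCount_eq_coeff, indecomposableCount_eq_coeff]
  have e7 := hF (n + 3)
  have e5 := hF (n + 1)
  have e4 := hF n
  have r := hF₂ (n + 1)
  have r1 := hF₁ (n + 2)
  have r2 := hF₁ (n + 1)
  simp only [add_assoc, Nat.reduceAdd] at e7 e5 e4 r r1 r2
  rw [e7, r, r1, r2, ← mul_add, mul_left_comm, mul_add, ← e5, ← e4, coeff_X_mul, coeff_add]

end Counting

/-! ### Multiplying all parts by c -/

section Scaling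

/-- The composition with all parts multiplied by `c`. -/
def scaleComposition {c : ℕ} (hc : 1 ≤ c) {n : ℕ} (a : Composition n) : Composition (c * n) where
  blocks := a.blocks.map (c * ·)
  blocks_pos := by
    intro i hi
    obtain ⟨p, hp, rfl⟩ := List.mem_map.1 hi
    exact Nat.mul_pos hc (a.blocks_pos hp)
  blocks_sum := by
    rw [List.sum_map_mul_left, List.map_id', a.blocks_sum]

theorem scaleComposition_injective {c : ℕ} (hc : 1 ≤ c) {n : ℕ} :
    Function.Injective (scaleComposition hc (n := n)) := fun _ _ h =>
  Composition.ext (List.map_injective_iff.2 (fun _ _ h => Nat.eq_of_mul_eq_mul_left hc h)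
    (congrArg Composition.blocks h))

theorem exists_map_mul_eq {c : ℕ} {l : List ℕ} (h : ∀ p ∈ l, p = c ∨ p = 3 * c) :
    ∃ l₀ ∈ oneThreeLists l₀.sum, l = l₀.map (c * ·) ∧ l.sum = c * l₀.sum := by
  induction l with
  | nil => exact ⟨[], by simp [mem_oneThreeLists], rfl, rfl⟩
  | cons p l ih =>
    obtain ⟨l₀, h1, rfl, h3⟩ := ih fun q hq => h q (List.mem_cons_of_mem _ hq)
    rcases h p List.mem_cons_self with rfl | rfl
    · refine ⟨1 :: l₀, cons_mem_oneThreeLists.2 ⟨.inl rfl, _, by simp, h1⟩, by simp, ?_⟩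
      rw [List.sum_cons, h3, List.sum_cons, mul_add, mul_one]
    · refine ⟨3 :: l₀, cons_mem_oneThreeLists.2 ⟨.inr rfl, _, by simp, h1⟩, ?_, ?_⟩
      · rw [List.map_cons, mul_comm]
      · rw [List.sum_cons, h3, List.sum_cons, mul_add, mul_comm]

theorem exists_eq_scaleComposition {c : ℕ} (hc : 1 ≤ c) {n : ℕ} {m : Meander (c * n)}
    (h : m.PartsIn {c, 3 * c}) : ∃ m₀ : Meander n, m₀.PartsIn {1, 3} ∧
      m = (scaleComposition hc m₀.1, scaleComposition hc m₀.2) := by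
  have key : ∀ a : Composition (c * n), (∀ p ∈ a.blocks, p ∈ ({c, 3 * c} : Set ℕ)) →
      ∃ a₀ : Composition n, a₀.blocks ∈ oneThreeLists n ∧ a = scaleComposition hc a₀ := by
    intro a ha
    obtain ⟨l, h1, h2, h3⟩ := exists_map_mul_eq ha
    have h4 : l.sum = n := by
      rw [a.blocks_sum] at h3
      exact (Nat.eq_of_mul_eq_mul_left hc h3).symm
    refine ⟨⟨l, fun {i} hi => ?_, h4⟩, h4 ▸ h1, Composition.ext h2⟩
    rcases (mem_oneThreeLists.1 h1).1 i hi with h | h <;> omega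
  obtain ⟨a, ha, ha'⟩ := key m.1 h.1
  obtain ⟨b, hb, hb'⟩ := key m.2 h.2
  exact ⟨(a, b), (partsIn_one_three_iff _).2 ⟨ha, hb⟩, Prod.ext ha' hb'⟩

variable (K : Type*) [Field K] [CharZero K]

theorem ind_scale {c : ℕ} (hc : 1 ≤ c) {n : ℕ} {m : Meander n} (hm : m.PartsIn {1, 3}) :
    Meander.ind K ((scaleComposition hc m.1, scaleComposition hc m.2) : Meander (c * n)) =
      c * m.ind K := by
  rw [partsIn_one_three_iff] at hm
  rw [ind_eq_listIndex, ind_eq_listIndex]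
  exact listIndex_map_mul K c hm.1 hm.2

theorem meanderCount_scale {c : ℕ} (hc : 1 ≤ c) (n k : ℕ) :
    meanderCount K {c, 3 * c} (c * n) (c * k) = meanderCount K {1, 3} n k := by
  have hinj : Function.Injective fun m : Meander n =>
      ((scaleComposition hc m.1, scaleComposition hc m.2) : Meander (c * n)) := fun m m' h =>
    Prod.ext (scaleComposition_injective hc (congrArg Prod.fst h))
      (scaleComposition_injective hc (congrArg Prod.snd h))
  rw [meanderCount, meanderCount, ← Set.ncard_image_of_injective _ hinj]
  congr 1
  ext m
  constructor
  · rintro ⟨h1, h2⟩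
    obtain ⟨m₀, h3, rfl⟩ := exists_eq_scaleComposition hc h1
    rw [ind_scale K hc h3] at h2
    exact ⟨m₀, ⟨h3, Nat.eq_of_mul_eq_mul_left hc h2⟩, rfl⟩
  · rintro ⟨m₀, ⟨h1, h2⟩, rfl⟩
    refine ⟨?_, by rw [ind_scale K hc h1, h2]⟩
    have key : ∀ a : Composition n, (∀ p ∈ a.blocks, p ∈ ({1, 3} : Set ℕ)) →
        ∀ p ∈ (scaleComposition hc a).blocks, p ∈ ({c, 3 * c} : Set ℕ) := by
      intro a ha p hp
      obtain ⟨q, hq, rfl⟩ := List.mem_map.1 hp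
      rcases ha q hq with h | h
      · exact .inl (by rw [h, mul_one])
      · exact .inr (by rw [Set.mem_singleton_iff.1 h, mul_comm]; rfl)
    exact ⟨key _ h1.1, key _ h1.2⟩

theorem dvd_of_meanderCount_ne_zero {c : ℕ} (hc : 1 ≤ c) {n k : ℕ}
    (h : meanderCount K {c, 3 * c} n k ≠ 0) : c ∣ n ∧ c ∣ k := by
  obtain ⟨m, h1, h2⟩ := Set.nonempty_of_ncard_ne_zero h
  obtain ⟨l, -, -, h3⟩ := exists_map_mul_eq h1.1
  rw [m.1.blocks_sum] at h3
  subst h3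
  obtain ⟨m₀, h4, rfl⟩ := exists_eq_scaleComposition hc h1
  rw [ind_scale K hc h4] at h2
  exact ⟨⟨_, rfl⟩, ⟨_, h2.symm⟩⟩

omit [CharZero K] in
theorem coeff_meanderSeries (J : Set ℕ) (d : Fin 2 →₀ ℕ) :
    MvPowerSeries.coeff d (meanderSeries K J) = (meanderCount K J (d 0) (d 1) : ℚ) := rfl

/-- Meanders with parts c and 3c are exactly the scaled ones, so coefficients at multiples of c
agree with the unscaled ones and all others vanish. -/
theorem meanderSeries_scale {c : ℕ} (hc : 1 ≤ c) : meanderSeries K {c, 3 * c} =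
    MvPowerSeries.expand c (Nat.pos_iff_ne_zero.1 hc) (meanderSeries K {1, 3}) := by
  ext d
  by_cases h : ∀ i, c ∣ d i
  · choose d' hd' using h
    obtain rfl : d = c • Finsupp.equivFunOnFinite.symm d' := by
      ext i
      simp [hd']
    rw [MvPowerSeries.coeff_expand_smul, coeff_meanderSeries, coeff_meanderSeries]
    exact congrArg _ (meanderCount_scale K hc _ _)
  · obtain ⟨i, hi⟩ := not_forall.1 h
    rw [MvPowerSeries.coeff_expand_of_not_dvd _ _ _ hi, coeff_meanderSeries, Nat.cast_eq_zero]
    by_contra h0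
    obtain ⟨h1, h2⟩ := dvd_of_meanderCount_ne_zero K hc h0
    refine hi ?_
    fin_cases i
    · exact h1
    · exact h2

end Scaling

/-! ### The generating function -/

section Series

open Polynomial

/-- The power series `∑ₙ pₙ(y) xⁿ`. -/
noncomputable def seriesOfCoeffs (p : ℕ → ℚ[X]) : MvPowerSeries (Fin 2) ℚ :=
  fun d => (p (d 0)).coeff (d 1)

theorem coeff_seriesOfCoeffs (p : ℕ → ℚ[X]) (d : Fin 2 →₀ ℕ) :
    MvPowerSeries.coeff d (seriesOfCoeffs p) = (p (d 0)).coeff (d 1) := rfl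

theorem seriesOfCoeffs_add (p q : ℕ → ℚ[X]) :
    seriesOfCoeffs (p + q) = seriesOfCoeffs p + seriesOfCoeffs q := by
  ext d
  simp [coeff_seriesOfCoeffs]

theorem X_zero_mul_seriesOfCoeffs (p : ℕ → ℚ[X]) : MvPowerSeries.X 0 * seriesOfCoeffs p =
    seriesOfCoeffs fun n => Nat.casesOn n 0 p := by
  classical
  ext d
  rw [MvPowerSeries.X, MvPowerSeries.coeff_monomial_mul, coeff_seriesOfCoeffs,
    coeff_seriesOfCoeffs]
  rcases h : d 0 with _ | n
  · rw [if_neg (by simp [h])]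
    simp
  · rw [if_pos (by simp [h])]
    simp [h]

theorem X_one_mul_seriesOfCoeffs (p : ℕ → ℚ[X]) : MvPowerSeries.X 1 * seriesOfCoeffs p =
    seriesOfCoeffs fun n => X * p n := by
  classical
  ext d
  rw [MvPowerSeries.X, MvPowerSeries.coeff_monomial_mul, coeff_seriesOfCoeffs,
    coeff_seriesOfCoeffs]
  rcases h : d 1 with _ | n
  · rw [if_neg (by simp [h])]
    simp
  · rw [if_pos (by simp [h])]
    simp [h]

theorem one_eq_seriesOfCoeffs :
    (1 : MvPowerSeries (Fin 2) ℚ) = seriesOfCoeffs fun n => Nat.casesOn n 1 0 := by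
  classical
  ext d
  rw [MvPowerSeries.coeff_one, coeff_seriesOfCoeffs]
  rcases h : d 0 with _ | n
  · rcases h' : d 1 with _ | k
    · rw [if_pos (by ext i; fin_cases i <;> simp [h, h'])]
      simp
    · rw [if_neg (by rintro rfl; simp at h')]
      simp [coeff_one]
  · rw [if_neg (by rintro rfl; simp at h)]
    simp

/-- The weight recursions become three linear equations between power series, with the small cases
of each recursion supplying its lowest coefficients. -/
theorem meanderSeries_one_three_mul (K : Type*) [Field K] [CharZero K]
    {x y : MvPowerSeries (Fin 2) ℚ} (hx : x = MvPowerSeries.X 0) (hy : y = MvPowerSeries.X 1) :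
    meanderSeries K {1, 3} * ((1 - x ^ 2 * y - x ^ 3 * y) * (1 - x * y - x ^ 3 * y ^ 3)
      - 2 * x ^ 3 * y ^ 2 * (1 + x)) = 1 - x ^ 2 * y - x ^ 3 * y := by
  have h := reductionWeight_index K
  set F : List ℕ → List ℕ → ℚ[X] := fun a b => X ^ listIndex K a.sum a b
  set F₁ : List ℕ → List ℕ → ℚ[X] := fun a b => X ^ listIndex K a.sum a (1 :: b)
  set F₂ : List ℕ → List ℕ → ℚ[X] := fun a b => X ^ listIndex K a.sum a (1 :: 1 :: b)
  let s : ℕ → ℚ[X] := fun n => pairSum n n F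
  let t₁ : ℕ → ℚ[X] := fun n => pairSum (n + 1) n F₁
  let t₂ : ℕ → ℚ[X] := fun n => pairSum (n + 2) n F₂
  have hs : meanderSeries K {1, 3} = seriesOfCoeffs s := by
    ext d
    exact meanderCount_eq_coeff K _ _
  have hx' : ∀ p, x * seriesOfCoeffs p = _ := hx ▸ X_zero_mul_seriesOfCoeffs
  have hy' : ∀ p, y * seriesOfCoeffs p = _ := hy ▸ X_one_mul_seriesOfCoeffs
  have hs0 : s 0 = 1 := by
    simp [s, F, pairSum, oneThreeLists, listIndex_zero]
  have e1 : seriesOfCoeffs s = 1 + x * (y * seriesOfCoeffs s) +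
      x * (x * (x * (y * (y * (y * seriesOfCoeffs s))))) +
      (x * (x * (x * seriesOfCoeffs t₂)) + x * (x * (x * seriesOfCoeffs t₂))) := by
    rw [one_eq_seriesOfCoeffs]
    simp only [hx', hy', ← seriesOfCoeffs_add]
    congr 1
    ext1 n
    rcases n with _ | _ | _ | n
    · simp [hs0]
    · simpa using h.sum_one
    · change s 2 = 0 + X * s 1 + 0 + (0 + 0)
      simpa using h.sum_two
    · have := h.sum_add_three n
      simp only [Pi.add_apply]
      change s (n + 3) = 0 + X * s (n + 2) + X * (X * (X * s n)) + (t₂ n + t₂ n)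
      change s (n + 3) = X * s (n + 2) + X ^ 3 * s n + 2 * t₂ n at this
      rw [this]
      ring
  have e2 : seriesOfCoeffs t₂ = y * seriesOfCoeffs t₁ + x * (y * seriesOfCoeffs t₁) := by
    simp only [hx', hy', ← seriesOfCoeffs_add]
    congr 1
    ext1 n
    rcases n with _ | n
    · simpa using h.sum_two_zero
    · exact h.sum_two_succ n
  have e3 : seriesOfCoeffs t₁ = y * seriesOfCoeffs s + x * (x * seriesOfCoeffs t₂) := by
    simp only [hx', hy', ← seriesOfCoeffs_add]
    congr 1
    ext1 n
    rcases n with _ | _ | n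
    · simpa using h.sum_rest_zero
    · simpa using h.sum_rest_one
    · exact h.sum_rest_add_two n
  rw [hs]
  -- Elimination: e2 and e3 give (1 - x²y - x³y)T₂ = y²(1 + x)S, which is substituted into e1
  -- multiplied by the factor on the left.
  linear_combination (1 - x ^ 2 * y - x ^ 3 * y) * e1 + 2 * x ^ 3 * e2 +
    2 * x ^ 3 * (y + x * y) * e3

end Series

theorem mainTheorem4 (K : Type*) [Field K] [CharZero K]
    (x y : MvPowerSeries (Fin 2) ℚ) (hx : x = MvPowerSeries.X 0) (hy : y = MvPowerSeries.X 1) :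
    meanderSeries K {1, 3} =
        (1 - x ^ 2 * y - x ^ 3 * y) *
          ((1 - x ^ 2 * y - x ^ 3 * y) * (1 - x * y - x ^ 3 * y ^ 3)
            - 2 * x ^ 3 * y ^ 2 * (1 + x))⁻¹ ∧
      (∀ n k : ℕ, 7 ≤ n → 1 ≤ k →
        indecomposableCount K {1, 3} n k =
          indecomposableCount K {1, 3} (n - 2) (k - 1) +
            indecomposableCount K {1, 3} (n - 3) (k - 1)) ∧
      ∀ c : ℕ, 1 ≤ c →
        meanderSeries K {c, 3 * c} =
          MvPowerSeries.subst ![x ^ c, y ^ c] (meanderSeries K {1, 3}) := by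
  refine ⟨?_, ?_, ?_⟩
  · rw [MvPowerSeries.eq_mul_inv_iff_mul_eq]
    · exact meanderSeries_one_three_mul K hx hy
    -- The denominator has constant term 1, so the inverse of power series is a genuine one.
    · simp [hx, hy]
  · intro n k hn hk
    obtain ⟨n, rfl⟩ := Nat.exists_eq_add_of_le' hn
    obtain ⟨k, rfl⟩ := Nat.exists_eq_add_of_le' hk
    exact indecomposableCount_add_seven K n k
  · intro c hc
    rw [meanderSeries_scale K hc, MvPowerSeries.expand, MvPowerSeries.substAlgHom_apply]
    congr 1
    ext i : 1
    fin_cases i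
    · simp [hx]
    · simp [hy]
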